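/- Let $E$ be a real vector space of finite dimension $n$ with dual $E^*$ and duality bracket $\langle\cdot,\cdot\rangle$. For a positive Radon measure $\mu$ on $E$ put $L_\mu(\theta)=\int_E e^{\langle\theta,x\rangle}\mu(dx)$, let $\Theta(\mu)$ be the interior of $\{\theta\in E^*:L_\mu(\theta)<\infty\}$, assume that $\Theta(\mu)\neq\emptyset$ and that $\mu$ is not concentrated on an affine hyperplane, and put $k_\mu=\log L_\mu$ on $\Theta(\mu)$. For the natural exponential family (NEF) $F=F(\mu)$ generated by $\mu$, let $M_F=k_\mu'(\Theta(\mu))\subset E$, let $\psi_\mu:M_F\to\Theta(\mu)$ be the inverse of $k'_\mu$, and let $V_F(m)=k_\mu''(\psi_\mu(m)):E^*\to E$ be the variance function. The NEF $F_1$ is called simple quadratic if $V_{F_1}(m)=q\,m\otimes m+B(m)+C$ on $M_{F_1}$, with $q\in\mathbb R$, $B$ linear in $m$ and $C$ constant, where $(m\otimes m)(\theta)=\langle\theta,m\rangle m$. The NEF $F$ is called simple cubic with parameter $\beta\in E^*$ if there is a simple quadratic NEF $F_1$ on $E$ such that for all $m\in M_F$ one has $1+\langle\beta,m\rangle>0$,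 $\frac{m}{1+\langle\beta,m\rangle}\in M_{F_1}$ and $$V_F(m)=(1+\langle\beta,m\rangle)\,(I_E+m\otimes\beta)\,V_{F_1}\Big(\frac{m}{1+\langle\beta,m\rangle}\Big)\,(I_{E^*}+\beta\otimes m),$$ where $(m\otimes\beta)(x)=\langle\beta,x\rangle m$ and $(\beta\otimes m)(\theta)=\langle\theta,m\rangle\beta$. **Proposition.** Let $F=F(\mu)$ be a simple cubic NEF on $E$ with parameter $\beta$. Then the following three properties hold. (1) There exist $a\in E$ and $b,c\in\mathbb R$ such that for all $m\in M_F$ $$\det V_F(m)=(1+\langle\beta,m\rangle)^{n+2}\exp\{\langle\psi_\mu(m),a\rangle+b\,k_\mu(\psi_\mu(m))+c\}.$$ Here the determinant is computed in a basis of $E$ and its dual basis; $a$ and $b$ do not depend on the basis, and $c$ may. (2) $V_F$ is differentiable on $M_F$ and there exist $a\in E$ and $b\in\mathbb R$ such that for all $m\in M_F$ and every basis $(e_i)_{i=1}^n$ of $E$ with dual basis $(e_i^*)_{i=1}^n$ $$\sum_{i=1}^n [V_F'(m)(e_i)]\,e_i^*=\frac{n+2}{1+\langle\beta,m\rangle}\,V_F(m)(\beta)+a+b\,m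 .$$ (3) For $t>0$ and $m_0\in M_F$ the measure $\exp\{t(\langle\theta,m_0\rangle-k_\mu(\theta))\}\mathbf 1_{\Theta(\mu)}(\theta)\,d\theta$ has finite positive mass; let $\pi_{t,m_0}$ be the probability measure proportional to it. There is an open set $\Omega\subset\mathbb R\times E$ such that the set of images of the measures $\pi_{t,m_0}$ ($t>0$, $m_0\in M_F$) under $k_\mu'$ is exactly $\{\widetilde\pi_{t,u}:(t,u)\in\Omega\}$, where $\widetilde\pi_{t,u}$ is the probability measure proportional to $$(1+\langle\beta,m\rangle)^{-n-2}\exp\{\langle\psi_\mu(m),u\rangle-t\,k_\mu(\psi_\mu(m))\}\,\mathbf 1_{\widetilde M}(m)\,dm,\qquad \widetilde M=\{m\in M_F:1+\langle\beta,m\rangle>0\}.$$ -/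

import Mathlib

namespace NEF

open MeasureTheory
open scoped ENNReal

noncomputable section

variable {E : Type*} [NormedAddCommGroup E] [NormedSpace ℝ E] [FiniteDimensional ℝ E]

section Bidual

theorem finrank_strongDual (V : Type*) [NormedAddCommGroup V] [NormedSpace ℝ V]
    [FiniteDimensional ℝ V] :
    Module.finrank ℝ (StrongDual ℝ V) = Module.finrank ℝ V := by
  rw [← (LinearMap.toContinuousLinearMap : (V →ₗ[ℝ] ℝ) ≃ₗ[ℝ] (V →L[ℝ] ℝ)).finrank_eq]
  exact Subspace.dual_finrank_eq

/-- The canonical identification of a finite-dimensional space `E` with its bidual: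
`x` goes to the evaluation `θ ↦ θ x`. -/
def bidual (E : Type*) [NormedAddCommGroup E] [NormedSpace ℝ E] [FiniteDimensional ℝ E] :
    E ≃ₗᵢ[ℝ] StrongDual ℝ (StrongDual ℝ E) :=
  (NormedSpace.inclusionInDoubleDualLi (E := E) ℝ).toLinearIsometryEquiv
    (by rw [finrank_strongDual, finrank_strongDual])

theorem bidual_apply (x : E) (θ : StrongDual ℝ E) : bidual E x θ = θ x := rfl

end Bidual

section Tensors

/-- `m ⊗ m : E* → E`, `θ ↦ ⟨θ, m⟩ m`. -/
def tensorSelf (m : E) : StrongDual ℝ E →L[ℝ] E :=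
  (NormedSpace.inclusionInDoubleDual ℝ E m).smulRight m

/-- `m ⊗ β : E → E`, `x ↦ ⟨β, x⟩ m`. -/
def tensorRight (m : E) (β : StrongDual ℝ E) : E →L[ℝ] E :=
  β.smulRight m

/-- `β ⊗ m : E* → E*`, `θ ↦ ⟨θ, m⟩ β`. -/
def tensorLeft (β : StrongDual ℝ E) (m : E) : StrongDual ℝ E →L[ℝ] StrongDual ℝ E :=
  (NormedSpace.inclusionInDoubleDual ℝ E m).smulRight β

/-- The dual basis of a basis `e` of `E`. -/
def dualBasisVec {n : ℕ} (e : Module.Basis (Fin n) ℝ E) (i : Fin n) : StrongDual ℝ E :=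
  LinearMap.toContinuousLinearMap (e.coord i)

/-- The determinant of `T : E* → E` computed in a basis `e` of `E` and its dual basis, i.e. the
determinant of the matrix `(⟨eᵢ*, T eⱼ*⟩)`. -/
def detIn {n : ℕ} (e : Module.Basis (Fin n) ℝ E) (T : StrongDual ℝ E →L[ℝ] E) : ℝ :=
  (Matrix.of fun i j => dualBasisVec e i (T (dualBasisVec e j))).det

end Tensors

section Families

variable [MeasurableSpace E]

/-- The Laplace transform `L_μ(θ) = ∫ exp⟨θ, x⟩ μ(dx)`, with values in `[0, ∞]`. -/
def laplace (μ : Measure E) (θ : StrongDual ℝ E) : ℝ≥0∞ :=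
  ∫⁻ x, ENNReal.ofReal (Real.exp (θ x)) ∂μ

/-- `Θ(μ)`, the interior of the set where the Laplace transform is finite. -/
def Theta (μ : Measure E) : Set (StrongDual ℝ E) :=
  interior {θ | laplace μ θ < ∞}

/-- Membership in `𝓜(E)`. The finiteness of `μ` on compact sets (so that `μ` is a Radon measure)
is automatic when `Θ(μ)` is non-empty. -/
structure IsBasis (μ : Measure E) : Prop where
  nonempty : (Theta μ).Nonempty
  not_concentrated : ∀ H : AffineSubspace ℝ E, H ≠ ⊤ → μ (H : Set E)ᶜ ≠ 0

/-- The cumulant function `k_μ = log L_μ`. -/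
def cumulant (μ : Measure E) (θ : StrongDual ℝ E) : ℝ :=
  Real.log (laplace μ θ).toReal

/-- The derivative `k'_μ`, with values in `E` (identified with the bidual of `E`). -/
def cumulantDeriv (μ : Measure E) (θ : StrongDual ℝ E) : E :=
  (bidual E).symm (fderiv ℝ (cumulant μ) θ)

/-- The domain of the means `M_F = k'_μ(Θ(μ))` of `F = F(μ)`. -/
def meanDomain (μ : Measure E) : Set E :=
  cumulantDeriv μ '' Theta μ

/-- `ψ_μ : M_F → Θ(μ)`, the inverse function of `k'_μ`. -/
def psi (μ : Measure E) (m : E) : StrongDual ℝ E :=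
  Function.invFunOn (cumulantDeriv μ) (Theta μ) m

/-- The variance function `V_F(m) = k''_μ(ψ_μ(m)) : E* → E` of `F = F(μ)`. -/
def variance (μ : Measure E) (m : E) : StrongDual ℝ E →L[ℝ] E :=
  fderiv ℝ (cumulantDeriv μ) (psi μ m)

/-- `F(μ)` is a simple quadratic natural exponential family:
`V_F(m) = q m ⊗ m + B(m) + C` with `q` real, `B` linear and `C` constant. -/
def IsSimpleQuadratic (μ : Measure E) : Prop :=
  IsBasis μ ∧
    ∃ (q : ℝ) (B : E →ₗ[ℝ] (StrongDual ℝ E →L[ℝ] E)) (C : StrongDual ℝ E →L[ℝ] E),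
      ∀ m ∈ meanDomain μ, variance μ m = q • tensorSelf m + B m + C

/-- `F(μ)` is a simple cubic natural exponential family with parameter `β`: there is a simple
quadratic family `F₁ = F(ν)` such that, for every `m` in `M_F`, `1 + ⟨β, m⟩ > 0`,
`m / (1 + ⟨β, m⟩)` is in `M_{F₁}`, and
`V_F(m) = (1 + ⟨β, m⟩) (I + m ⊗ β) V_{F₁}(m / (1 + ⟨β, m⟩)) (I + β ⊗ m)`. -/
def IsSimpleCubic (μ : Measure E) (β : StrongDual ℝ E) : Prop :=
  IsBasis μ ∧
    ∃ ν : Measure E, IsSimpleQuadratic ν ∧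
      ∀ m ∈ meanDomain μ,
        0 < 1 + β m ∧ (1 + β m)⁻¹ • m ∈ meanDomain ν ∧
          variance μ m =
            (1 + β m) •
              ((ContinuousLinearMap.id ℝ E + tensorRight m β) ∘L
                variance ν ((1 + β m)⁻¹ • m) ∘L
                  (ContinuousLinearMap.id ℝ (StrongDual ℝ E) + tensorLeft β m))

/-- The Monge-Ampère property:
`det V_F(m) = (1 + ⟨β, m⟩)^(n+2) exp (⟨a, ψ_μ(m)⟩ + b k_μ(ψ_μ(m)) + c)` on `M_F`. The determinant
is taken in a basis of `E` and its dual basis; replacing the basis by another one multiplies it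
by a positive constant, so only `c` may depend on the basis. -/
def MongeAmpereProperty (μ : Measure E) (β : StrongDual ℝ E) : Prop :=
  ∃ (a : E) (b : ℝ), ∀ e : Module.Basis (Fin (Module.finrank ℝ E)) ℝ E, ∃ c : ℝ,
    ∀ m ∈ meanDomain μ,
      detIn e (variance μ m) =
        (1 + β m) ^ (Module.finrank ℝ E + 2) *
          Real.exp (psi μ m a + b * cumulant μ (psi μ m) + c)

/-- The differential equation for the variance function:
`∑ᵢ [V_F'(m)(eᵢ)] eᵢ* = (n+2) / (1 + ⟨β, m⟩) V_F(m)(β) + a + b m` on `M_F`, for every basis `e`. -/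
def VarianceEquationProperty (μ : Measure E) (β : StrongDual ℝ E) : Prop :=
  ∃ (a : E) (b : ℝ), ∀ m ∈ meanDomain μ,
    DifferentiableAt ℝ (variance μ) m ∧
      ∀ e : Module.Basis (Fin (Module.finrank ℝ E)) ℝ E,
        ∑ i, (fderiv ℝ (variance μ) m (e i)) (dualBasisVec e i) =
          (((Module.finrank ℝ E : ℝ) + 2) / (1 + β m)) • variance μ m β + a + b • m

end Families

section Priors

variable [MeasurableSpace E] [BorelSpace E]

/-- The measure `ρ` divided by its total mass. -/
def normalized {X : Type*} [MeasurableSpace X] (ρ : Measure X) : Measure X :=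
  (ρ Set.univ)⁻¹ • ρ

/-- The conjugate prior
`π_{t,m₀}(dθ) = C exp (t (⟨m₀, θ⟩ - k_μ(θ))) 1_{Θ(μ)}(θ) dθ`.
The normalization makes the choice of Lebesgue measure `dθ` on `E*` irrelevant. -/
def prior (μ : Measure E) (t : ℝ) (m₀ : E) : Measure (StrongDual ℝ E) :=
  normalized (((Measure.addHaar : Measure (StrongDual ℝ E)).restrict (Theta μ)).withDensity
    fun θ => ENNReal.ofReal (Real.exp (t * (θ m₀ - cumulant μ θ))))

/-- `M̃ = k'_μ({θ ∈ Θ(μ) : 1 + ⟨β, k'_μ(θ)⟩ > 0})`. -/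
def meanDomainTilde (μ : Measure E) (β : StrongDual ℝ E) : Set E :=
  cumulantDeriv μ '' {θ | θ ∈ Theta μ ∧ 0 < 1 + β (cumulantDeriv μ θ)}

/-- The prior on the domain of the means
`C (1 + ⟨β, m⟩)^(-n-2) exp (⟨u, ψ_μ(m)⟩ - t k_μ(ψ_μ(m))) 1_{M̃}(m) dm`, in its natural
parametrization; the exponent is `t (⟨m₀, ψ_μ(m)⟩ - k_μ(ψ_μ(m)))` for `u = t m₀`. -/
def priorTilde (μ : Measure E) (β : StrongDual ℝ E) (t : ℝ) (u : E) : Measure E :=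
  normalized (((Measure.addHaar : Measure E).restrict (meanDomainTilde μ β)).withDensity
    fun m => ENNReal.ofReal (((1 + β m) ^ (Module.finrank ℝ E + 2))⁻¹ *
      Real.exp (psi μ m u - t * cumulant μ (psi μ m))))

/-- The equality of two families of priors: the conjugate priors are genuine probability
distributions, and their images by `k'_μ` are exactly the members of the second family with
parameters in some open set `Ω`. -/
def PriorProperty (μ : Measure E) (β : StrongDual ℝ E) : Prop :=
  (∀ t : ℝ, 0 < t → ∀ m₀ ∈ meanDomain μ, IsProbabilityMeasure (prior μ t m₀)) ∧
    ∃ Ω : Set (ℝ × E), IsOpen Ω ∧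
      {ρ : Measure E | ∃ t : ℝ, 0 < t ∧ ∃ m₀ ∈ meanDomain μ,
          ρ = (prior μ t m₀).map (cumulantDeriv μ)} =
        {ρ : Measure E | ∃ p ∈ Ω, ρ = priorTilde μ β p.1 p.2}

end Priors

end

end NEF

/-!
Write `s = 1 + ⟨β, m⟩`. The variance equation is an identity between polynomials: substituting the
quadratic form of `V_{F₁}` shows that on `M_F` the variance function is
`cubicForm q B C β m = q s m ⊗ m + (I + m ⊗ β) (B(m) + s C) (I + β ⊗ m)`, and a direct computation of
its divergence (`sum_fderiv_cubicForm`) gives the equation with `a = ∑ᵢ B(eᵢ) eᵢ*` and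
`b = (n + 1) q + ⟨β, a⟩`. The only property of the second family that matters is the symmetry of
its variance function. The computation can be differentiated because `M_F` is open.

The Monge-Ampère equation is the integrated form of the variance equation. Since third derivatives
of `k_μ` are symmetric, the derivative of `log det k_μ''` at `θ` is the divergence of `V_F` at
`k_μ'(θ)`, viewed as a linear form on `E*` (`IsBasis.hasFDerivAt_log_detIn`). By the variance
equation this is the derivative of `(n + 2) log (1 + ⟨β, k_μ'⟩) + ⟨·, a⟩ + b k_μ`, and `Θ(μ)` is
convex.

Finally, `|det k_μ''|⁻¹` is the Jacobian factor in the change of variables `m = k_μ'(θ)`. The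
Monge-Ampère equation turns the image of the conjugate prior with parameters `(t, m₀)` into the
prior on `M_F` with parameters `(t + b, t m₀ - a)` (`IsSimpleCubic.map_prior_eq`); these parameters
fill an open set because `M_F` is open. The conjugate priors have finite mass because
`k_μ - ⟨·, m₀⟩` is convex with a strict minimum in `Θ(μ)` (`IsBasis.exists_linear_growth`).

The analysis behind this is that exponential integrals can be differentiated on `Θ(μ)`
(`hasStrictFDerivAt_integral_exp_smul`), so that `k_μ` is twice continuously differentiable, and that
its Hessian is a covariance, which is positive definite when `μ` is not carried by a hyperplane
(`IsBasis.fderiv_cumulantDeriv_pos`). Consequently `k_μ'` is injective and open on `Θ(μ)`.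
-/

namespace NEF

open MeasureTheory Filter Topology
open scoped ENNReal

/-! ### Exponential integrals and their derivatives -/

section TensorEval

variable {E : Type*} [NormedAddCommGroup E] [NormedSpace ℝ E]
  {G : Type*} [NormedAddCommGroup G] [NormedSpace ℝ G]

/-- `x ↦ x ⊗ φ x`, the factor that appears when `∫ exp (θ x) φ x μ(dx)` is differentiated. -/
noncomputable def tensorEval (φ : E → G) (x : E) : StrongDual ℝ E →L[ℝ] G :=
  (NormedSpace.inclusionInDoubleDual ℝ E x).smulRight (φ x)

theorem tensorEval_apply (φ : E → G) (x : E) (θ : StrongDual ℝ E) :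
    tensorEval φ x θ = θ x • φ x := rfl

theorem continuous_tensorEval {φ : E → G} (hφ : Continuous φ) : Continuous (tensorEval φ) := by
  have h : tensorEval φ = fun x => ContinuousLinearMap.smulRightL ℝ (StrongDual ℝ E) G
      (NormedSpace.inclusionInDoubleDual ℝ E x) (φ x) := by
    funext x
    rfl
  rw [h]
  fun_prop

theorem norm_tensorEval_le {φ : E → G} {C : ℝ} {j : ℕ} (hb : ∀ x, ‖φ x‖ ≤ C * ‖x‖ ^ j) (x : E) :
    ‖tensorEval φ x‖ ≤ C * ‖x‖ ^ (j + 1) := by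
  rw [tensorEval, ContinuousLinearMap.norm_smulRight_apply]
  calc ‖NormedSpace.inclusionInDoubleDual ℝ E x‖ * ‖φ x‖ ≤ ‖x‖ * (C * ‖x‖ ^ j) :=
        mul_le_mul (NormedSpace.double_dual_bound ℝ E x) (hb x) (norm_nonneg _) (norm_nonneg _)
    _ = C * ‖x‖ ^ (j + 1) := by ring

end TensorEval

section ExponentialIntegrals

variable {E : Type*} [NormedAddCommGroup E] [NormedSpace ℝ E] [FiniteDimensional ℝ E]
  [MeasurableSpace E] [BorelSpace E] {μ : Measure E}

theorem isOpen_Theta (μ : Measure E) : IsOpen (Theta μ) := isOpen_interior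

theorem integrable_exp_of_laplace_lt_top {θ : StrongDual ℝ E} (h : laplace μ θ < ⊤) :
    Integrable (fun x => Real.exp (θ x)) μ := by
  refine ⟨by fun_prop, ?_⟩
  rw [hasFiniteIntegral_iff_ofReal (ae_of_all _ fun x => (Real.exp_pos _).le)]
  exact h

theorem integrable_exp {θ : StrongDual ℝ E} (h : θ ∈ Theta μ) :
    Integrable (fun x => Real.exp (θ x)) μ :=
  integrable_exp_of_laplace_lt_top (interior_subset (s := {θ | laplace μ θ < ⊤}) h)

/-- At an interior point `θ` of the domain of the Laplace transform there is room for an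
exponential of the norm: up to a constant, the norm is the largest of finitely many functionals
`±eᵢ*`, so `exp (ε ‖x‖)` is at most a sum of exponentials of small functionals. -/
theorem exists_integrable_exp_add_norm {θ : StrongDual ℝ E} (h : θ ∈ Theta μ) :
    ∃ ε > 0, Integrable (fun x => Real.exp (θ x + ε * ‖x‖)) μ := by
  obtain ⟨r, hr, hball⟩ := Metric.mem_nhds_iff.1 (mem_interior_iff_mem_nhds.1 h)
  set e := Module.finBasis ℝ E
  set f : Fin (Module.finrank ℝ E) → StrongDual ℝ E := dualBasisVec e
  set S : ℝ := ∑ i, ‖f i‖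
  set T : ℝ := ∑ i, ‖e i‖
  have hS : 0 ≤ S := by positivity
  have hT : 0 ≤ T := by positivity
  set δ : ℝ := r / (1 + S)
  have hδ : 0 < δ := by positivity
  have hnear : ∀ (c : ℝ), |c| = δ → ∀ i, Integrable (fun x => Real.exp ((θ + c • f i) x)) μ := by
    intro c hc i
    refine integrable_exp_of_laplace_lt_top (hball (?_ : _ ∈ _))
    rw [Metric.mem_ball, dist_eq_norm, add_sub_cancel_left, norm_smul, Real.norm_eq_abs, hc]
    have h1 : ‖f i‖ ≤ S :=
      Finset.single_le_sum (f := fun i => ‖f i‖) (fun _ _ => norm_nonneg _) (Finset.mem_univ i)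
    rw [div_mul_eq_mul_div, div_lt_iff₀ (by positivity)]
    nlinarith
  refine ⟨δ / (1 + T), by positivity, ?_⟩
  -- the summand `exp (θ x)` is only needed in dimension zero, where the sum is empty
  have hdom : Integrable (fun x => Real.exp (θ x) +
      ∑ i, (Real.exp ((θ + δ • f i) x) + Real.exp ((θ + (-δ) • f i) x))) μ :=
    (integrable_exp h).add (integrable_finsetSum _ fun i _ =>
      (hnear δ (abs_of_pos hδ) i).add (hnear (-δ) (by rw [abs_neg, abs_of_pos hδ]) i))
  refine hdom.mono' (by fun_prop) (ae_of_all _ fun x => ?_)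
  rw [Real.norm_eq_abs, abs_of_pos (Real.exp_pos _)]
  have hpos : ∀ i, 0 ≤ Real.exp ((θ + δ • f i) x) + Real.exp ((θ + (-δ) • f i) x) :=
    fun i => by positivity
  have hx : ‖x‖ ≤ ∑ i, |f i x| * ‖e i‖ := by
    conv_lhs => rw [← e.sum_repr x]
    refine (norm_sum_le _ _).trans (Finset.sum_le_sum fun i _ => ?_)
    rw [norm_smul, Real.norm_eq_abs]
    rfl
  rcases isEmpty_or_nonempty (Fin (Module.finrank ℝ E)) with hE | hE
  · have : ‖x‖ = 0 := le_antisymm (by simpa using hx) (norm_nonneg _)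
    simp [this]
  · obtain ⟨i, hi⟩ := Finite.exists_max fun i => |f i x|
    have hxi : ‖x‖ ≤ |f i x| * T := by
      rw [Finset.mul_sum]
      exact hx.trans (Finset.sum_le_sum fun j _ =>
        mul_le_mul_of_nonneg_right (hi j) (norm_nonneg _))
    have hle : δ / (1 + T) * ‖x‖ ≤ δ * |f i x| := by
      rw [div_mul_eq_mul_div, div_le_iff₀ (by positivity)]
      nlinarith [abs_nonneg (f i x), mul_nonneg hδ.le (abs_nonneg (f i x))]
    have hexp : Real.exp (θ x + δ / (1 + T) * ‖x‖) ≤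
        Real.exp ((θ + δ • f i) x) + Real.exp ((θ + (-δ) • f i) x) := by
      simp only [add_apply, smul_apply, smul_eq_mul]
      rcases abs_cases (f i x) with ⟨h1, -⟩ | ⟨h1, -⟩
      · refine le_trans (Real.exp_le_exp.2 ?_) (le_add_of_nonneg_right (Real.exp_pos _).le)
        rw [h1] at hle
        linarith
      · refine le_trans (Real.exp_le_exp.2 ?_) (le_add_of_nonneg_left (Real.exp_pos _).le)
        rw [h1] at hle
        linarith
    have hsum := Finset.single_le_sum
      (f := fun i => Real.exp ((θ + δ • f i) x) + Real.exp ((θ + (-δ) • f i) x))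
      (fun i _ => hpos i) (Finset.mem_univ i)
    have := Real.exp_pos (θ x)
    linarith

/-- Integrals `∫ exp (θ x) φ x μ(dx)` with `φ` of polynomial growth are dominated, locally
uniformly in `θ`. -/
theorem exists_bound_exp_smul {θ₀ : StrongDual ℝ E} (h : θ₀ ∈ Theta μ) (C : ℝ) (j : ℕ) :
    ∃ r > 0, ∃ g : E → ℝ, Integrable g μ ∧
      ∀ θ ∈ Metric.ball θ₀ r, ∀ x, Real.exp (θ x) * (C * ‖x‖ ^ j) ≤ g x := by
  obtain ⟨ε, hε, hint⟩ := exists_integrable_exp_add_norm h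
  refine ⟨ε / 2, by positivity,
    fun x => (|C| * (j.factorial / (ε / 2) ^ j)) * Real.exp (θ₀ x + ε * ‖x‖),
    hint.const_mul _, fun θ hθ x => ?_⟩
  have h1 : θ x ≤ θ₀ x + ε / 2 * ‖x‖ := by
    have h2 : (θ - θ₀) x ≤ ‖θ - θ₀‖ * ‖x‖ := (le_abs_self _).trans ((θ - θ₀).le_opNorm x)
    rw [mem_ball_iff_norm] at hθ
    have h3 : ‖θ - θ₀‖ * ‖x‖ ≤ ε / 2 * ‖x‖ := by gcongr
    rw [sub_apply] at h2
    linarith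
  have h4 : ‖x‖ ^ j ≤ (j.factorial / (ε / 2) ^ j) * Real.exp (ε / 2 * ‖x‖) := by
    have := Real.pow_div_factorial_le_exp (ε / 2 * ‖x‖) (by positivity) j
    rw [div_le_iff₀ (by positivity), mul_pow] at this
    rw [div_mul_eq_mul_div, le_div_iff₀ (by positivity)]
    linarith
  calc Real.exp (θ x) * (C * ‖x‖ ^ j)
      ≤ Real.exp (θ₀ x + ε / 2 * ‖x‖) *
          (|C| * ((j.factorial / (ε / 2) ^ j) * Real.exp (ε / 2 * ‖x‖))) := by
        refine (mul_le_mul_of_nonneg_left ?_ (Real.exp_pos _).le).trans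
          (mul_le_mul_of_nonneg_right (Real.exp_le_exp.2 h1) (by positivity))
        exact (mul_le_mul_of_nonneg_right (le_abs_self C) (by positivity)).trans
          (mul_le_mul_of_nonneg_left h4 (abs_nonneg C))
    _ = (|C| * (j.factorial / (ε / 2) ^ j)) * Real.exp (θ₀ x + ε * ‖x‖) := by
        rw [show θ₀ x + ε * ‖x‖ = (θ₀ x + ε / 2 * ‖x‖) + ε / 2 * ‖x‖ by ring,
          Real.exp_add (θ₀ x + ε / 2 * ‖x‖)]
        ring

variable {G : Type*} [NormedAddCommGroup G] [NormedSpace ℝ G]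

theorem integrable_exp_smul {φ : E → G} (hφ : Continuous φ) {C : ℝ} {j : ℕ}
    (hb : ∀ x, ‖φ x‖ ≤ C * ‖x‖ ^ j) {θ : StrongDual ℝ E} (h : θ ∈ Theta μ) :
    Integrable (fun x => Real.exp (θ x) • φ x) μ := by
  obtain ⟨r, hr, g, hg, hle⟩ := exists_bound_exp_smul (μ := μ) h C j
  refine hg.mono' (by fun_prop) (ae_of_all _ fun x => ?_)
  rw [norm_smul, Real.norm_eq_abs, abs_of_pos (Real.exp_pos _)]
  exact (mul_le_mul_of_nonneg_left (hb x) (Real.exp_pos _).le).trans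
    (hle θ (Metric.mem_ball_self hr) x)

theorem hasFDerivAt_integral_exp_smul {φ : E → G} (hφ : Continuous φ) {C : ℝ} {j : ℕ}
    (hb : ∀ x, ‖φ x‖ ≤ C * ‖x‖ ^ j) {θ₀ : StrongDual ℝ E} (h : θ₀ ∈ Theta μ) :
    HasFDerivAt (fun θ : StrongDual ℝ E => ∫ x, Real.exp (θ x) • φ x ∂μ)
      (∫ x, Real.exp (θ₀ x) • tensorEval φ x ∂μ) θ₀ := by
  obtain ⟨r, hr, g, hg, hle⟩ := exists_bound_exp_smul (μ := μ) h C (j + 1)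
  have hcont := continuous_tensorEval hφ
  refine hasFDerivAt_integral_of_dominated_of_fderiv_le
    (F := fun θ x => Real.exp (θ x) • φ x)
    (F' := fun θ x => Real.exp (θ x) • tensorEval φ x) (Metric.ball_mem_nhds θ₀ hr)
    (Eventually.of_forall fun θ => by fun_prop) (integrable_exp_smul hφ hb h)
    (integrable_exp_smul hcont (norm_tensorEval_le hb) h).aestronglyMeasurable
    (ae_of_all _ fun x θ hθ => ?_) hg (ae_of_all _ fun x θ _ => ?_)
  · rw [norm_smul, Real.norm_eq_abs, abs_of_pos (Real.exp_pos _)]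
    exact (mul_le_mul_of_nonneg_left (norm_tensorEval_le hb x) (Real.exp_pos _).le).trans
      (hle θ hθ x)
  · have h1 : HasFDerivAt (fun θ : StrongDual ℝ E => θ x)
        (NormedSpace.inclusionInDoubleDual ℝ E x) θ :=
      (NormedSpace.inclusionInDoubleDual ℝ E x).hasFDerivAt
    refine (h1.exp.smul_const (φ x)).congr_fderiv ?_
    ext η
    simp [tensorEval_apply, mul_smul]

theorem hasStrictFDerivAt_integral_exp_smul {φ : E → G} (hφ : Continuous φ) {C : ℝ} {j : ℕ}
    (hb : ∀ x, ‖φ x‖ ≤ C * ‖x‖ ^ j) {θ₀ : StrongDual ℝ E} (h : θ₀ ∈ Theta μ) :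
    HasStrictFDerivAt (fun θ : StrongDual ℝ E => ∫ x, Real.exp (θ x) • φ x ∂μ)
      (∫ x, Real.exp (θ₀ x) • tensorEval φ x ∂μ) θ₀ := by
  refine hasStrictFDerivAt_of_hasFDerivAt_of_continuousAt
    (f' := fun θ : StrongDual ℝ E => ∫ x, Real.exp (θ x) • tensorEval φ x ∂μ) ?_ ?_
  · filter_upwards [(isOpen_Theta μ).mem_nhds h] with θ hθ
    exact hasFDerivAt_integral_exp_smul hφ hb hθ
  · exact (hasFDerivAt_integral_exp_smul (continuous_tensorEval hφ)
      (norm_tensorEval_le hb) h).continuousAt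

end ExponentialIntegrals

/-! ### The cumulant function and its Hessian -/

section Cumulant

variable {E : Type*} [NormedAddCommGroup E] [NormedSpace ℝ E] [FiniteDimensional ℝ E]
  [MeasurableSpace E] [BorelSpace E] {μ : Measure E}

theorem toReal_laplace (μ : Measure E) (θ : StrongDual ℝ E) :
    (laplace μ θ).toReal = ∫ x, Real.exp (θ x) ∂μ := by
  rw [integral_eq_lintegral_of_nonneg_ae (ae_of_all _ fun x => (Real.exp_pos _).le) (by fun_prop)]
  rfl

theorem IsBasis.ne_zero (hμ : IsBasis μ) : μ ≠ 0 := by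
  rintro rfl
  have : Nonempty E := ⟨0⟩
  exact hμ.not_concentrated ⊥ bot_ne_top rfl

theorem IsBasis.integral_exp_pos (hμ : IsBasis μ) {θ : StrongDual ℝ E} (h : θ ∈ Theta μ) :
    0 < ∫ x, Real.exp (θ x) ∂μ := by
  have : NeZero μ := ⟨hμ.ne_zero⟩
  exact MeasureTheory.integral_exp_pos (integrable_exp h)

theorem integrable_exp_smul_id {θ : StrongDual ℝ E} (h : θ ∈ Theta μ) :
    Integrable (fun x => Real.exp (θ x) • x) μ :=
  integrable_exp_smul (C := 1) (j := 1) continuous_id (fun x => by simp) h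

theorem integrable_exp_mul_apply {θ : StrongDual ℝ E} (h : θ ∈ Theta μ) (η : StrongDual ℝ E) :
    Integrable (fun x => Real.exp (θ x) * η x) μ :=
  integrable_exp_smul (C := ‖η‖) (j := 1) η.continuous (fun x => by simpa using η.le_opNorm x) h

theorem integrable_exp_mul_apply_mul_apply {θ : StrongDual ℝ E} (h : θ ∈ Theta μ)
    (η ζ : StrongDual ℝ E) : Integrable (fun x => Real.exp (θ x) * (η x * ζ x)) μ :=
  integrable_exp_smul (C := ‖η‖ * ‖ζ‖) (j := 2) (η.continuous.mul ζ.continuous) (fun x => by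
    rw [Pi.mul_apply, norm_mul]
    calc ‖η x‖ * ‖ζ x‖ ≤ (‖η‖ * ‖x‖) * (‖ζ‖ * ‖x‖) :=
          mul_le_mul (η.le_opNorm x) (ζ.le_opNorm x) (norm_nonneg _) (by positivity)
      _ = ‖η‖ * ‖ζ‖ * ‖x‖ ^ 2 := by ring) h

theorem apply_integral_exp_smul_id {θ : StrongDual ℝ E} (h : θ ∈ Theta μ) (η : StrongDual ℝ E) :
    η (∫ x, Real.exp (θ x) • x ∂μ) = ∫ x, Real.exp (θ x) * η x ∂μ := by
  rw [← ContinuousLinearMap.integral_comp_comm η (integrable_exp_smul_id h)]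
  simp

theorem hasStrictFDerivAt_integral_exp {θ : StrongDual ℝ E} (h : θ ∈ Theta μ) :
    HasStrictFDerivAt (fun θ : StrongDual ℝ E => ∫ x, Real.exp (θ x) ∂μ)
      (bidual E (∫ x, Real.exp (θ x) • x ∂μ)) θ := by
  have hb : ∀ x : E, ‖(1 : ℝ)‖ ≤ 1 * ‖x‖ ^ 0 := by simp
  have h1 := hasStrictFDerivAt_integral_exp_smul (μ := μ) (φ := fun _ => (1 : ℝ))
    continuous_const hb h
  simp only [smul_eq_mul, mul_one] at h1
  refine h1.congr_fderiv ?_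
  ext η
  rw [bidual_apply, apply_integral_exp_smul_id h, ContinuousLinearMap.integral_apply
    (integrable_exp_smul (continuous_tensorEval continuous_const) (norm_tensorEval_le hb) h)]
  simp [tensorEval_apply]

theorem IsBasis.hasFDerivAt_cumulant_aux (hμ : IsBasis μ) {θ : StrongDual ℝ E}
    (h : θ ∈ Theta μ) :
    HasFDerivAt (cumulant μ)
      (bidual E ((∫ x, Real.exp (θ x) ∂μ)⁻¹ • ∫ x, Real.exp (θ x) • x ∂μ)) θ := by
  have h1 : cumulant μ = fun θ => Real.log (∫ x, Real.exp (θ x) ∂μ) := by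
    funext η
    rw [cumulant, toReal_laplace]
  rw [h1, map_smul]
  exact (hasStrictFDerivAt_integral_exp h).hasFDerivAt.log (hμ.integral_exp_pos h).ne'

theorem IsBasis.cumulantDeriv_eq (hμ : IsBasis μ) {θ : StrongDual ℝ E} (h : θ ∈ Theta μ) :
    cumulantDeriv μ θ = (∫ x, Real.exp (θ x) ∂μ)⁻¹ • ∫ x, Real.exp (θ x) • x ∂μ := by
  rw [cumulantDeriv, (hμ.hasFDerivAt_cumulant_aux h).fderiv, LinearIsometryEquiv.symm_apply_apply]

theorem IsBasis.hasFDerivAt_cumulant (hμ : IsBasis μ) {θ : StrongDual ℝ E} (h : θ ∈ Theta μ) :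
    HasFDerivAt (cumulant μ) (bidual E (cumulantDeriv μ θ)) θ := by
  rw [hμ.cumulantDeriv_eq h]
  exact hμ.hasFDerivAt_cumulant_aux h

/-- The second derivative of the cumulant function is the covariance of the exponentially tilted
measure. -/
theorem IsBasis.exists_hasStrictFDerivAt_cumulantDeriv (hμ : IsBasis μ) {θ : StrongDual ℝ E}
    (h : θ ∈ Theta μ) :
    ∃ K : StrongDual ℝ E →L[ℝ] E, HasStrictFDerivAt (cumulantDeriv μ) K θ ∧
      ∀ η ζ : StrongDual ℝ E, ζ (K η) =
        (∫ x, Real.exp (θ x) ∂μ)⁻¹ * ∫ x, Real.exp (θ x) * (η x * ζ x) ∂μ -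
          (∫ x, Real.exp (θ x) ∂μ)⁻¹ ^ 2 *
            ((∫ x, Real.exp (θ x) * η x ∂μ) * ∫ x, Real.exp (θ x) * ζ x ∂μ) := by
  have hpos := hμ.integral_exp_pos h
  have hb : ∀ x : E, ‖id x‖ ≤ 1 * ‖x‖ ^ 1 := by simp
  have h1 := hasStrictFDerivAt_integral_exp_smul (μ := μ) continuous_id hb h
  have h2 := ((hasStrictDerivAt_inv hpos.ne').comp_hasStrictFDerivAt θ
    (hasStrictFDerivAt_integral_exp h)).smul h1
  refine ⟨_, h2.congr_of_eventuallyEq ?_, fun η ζ => ?_⟩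
  · filter_upwards [(isOpen_Theta μ).mem_nhds h] with ξ hξ
    simp [hμ.cumulantDeriv_eq hξ]
  · have hint := integrable_exp_smul (μ := μ) (φ := tensorEval (id : E → E))
      (continuous_tensorEval continuous_id) (norm_tensorEval_le hb) h
    have h3 : ζ ((∫ x, Real.exp (θ x) • tensorEval id x ∂μ) η) =
        ∫ x, Real.exp (θ x) * (η x * ζ x) ∂μ := by
      rw [ContinuousLinearMap.integral_apply hint,
        ← ContinuousLinearMap.integral_comp_comm ζ (hint.apply_continuousLinearMap η)]
      simp [tensorEval_apply]
    have h4 := apply_integral_exp_smul_id h η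
    have h5 := apply_integral_exp_smul_id h ζ
    simp only [add_apply, smul_apply, ContinuousLinearMap.smulRight_apply, map_add, map_smul,
      smul_eq_mul, h3, bidual_apply, id, Function.comp, h4, h5]
    field_simp
    ring

theorem IsBasis.hasStrictFDerivAt_cumulantDeriv (hμ : IsBasis μ) {θ : StrongDual ℝ E}
    (h : θ ∈ Theta μ) :
    HasStrictFDerivAt (cumulantDeriv μ) (fderiv ℝ (cumulantDeriv μ) θ) θ := by
  obtain ⟨K, hK, -⟩ := hμ.exists_hasStrictFDerivAt_cumulantDeriv h
  rwa [hK.hasFDerivAt.fderiv]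

theorem IsBasis.continuousOn_cumulantDeriv (hμ : IsBasis μ) :
    ContinuousOn (cumulantDeriv μ) (Theta μ) := fun _ h =>
  (hμ.hasStrictFDerivAt_cumulantDeriv h).continuousAt.continuousWithinAt

theorem IsBasis.fderiv_cumulantDeriv_symm (hμ : IsBasis μ) {θ : StrongDual ℝ E}
    (h : θ ∈ Theta μ) (η ζ : StrongDual ℝ E) :
    ζ (fderiv ℝ (cumulantDeriv μ) θ η) = η (fderiv ℝ (cumulantDeriv μ) θ ζ) := by
  obtain ⟨K, hK, hf⟩ := hμ.exists_hasStrictFDerivAt_cumulantDeriv h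
  rw [hK.hasFDerivAt.fderiv, hf, hf, mul_comm (∫ x, Real.exp (θ x) * η x ∂μ)]
  simp only [mul_comm (η _)]

/-- The Hessian of the cumulant function is positive definite, because a variance
vanishes only when the functional is almost everywhere constant, that is, when the measure sits on
an affine hyperplane. -/
theorem IsBasis.fderiv_cumulantDeriv_pos (hμ : IsBasis μ) {θ : StrongDual ℝ E}
    (h : θ ∈ Theta μ) {η : StrongDual ℝ E} (hη : η ≠ 0) :
    0 < η (fderiv ℝ (cumulantDeriv μ) θ η) := by
  obtain ⟨K, hK, hf⟩ := hμ.exists_hasStrictFDerivAt_cumulantDeriv h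
  rw [hK.hasFDerivAt.fderiv, hf]
  have hL := hμ.integral_exp_pos h
  set L := ∫ x, Real.exp (θ x) ∂μ
  set A := ∫ x, Real.exp (θ x) * η x ∂μ
  -- the mean of `η` under the tilted measure, so that the claim is the positivity of a variance
  set c := L⁻¹ * A with hc
  have hi0 := integrable_exp h
  have hi1 := integrable_exp_mul_apply h η
  have hi2 := integrable_exp_mul_apply_mul_apply h η η
  have hexp : (fun x => Real.exp (θ x) * (η x - c) ^ 2) = fun x =>
      Real.exp (θ x) * (η x * η x) - 2 * c * (Real.exp (θ x) * η x) + c ^ 2 * Real.exp (θ x) := by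
    funext x
    ring
  have hint : Integrable (fun x => Real.exp (θ x) * (η x - c) ^ 2) μ := by
    rw [hexp]
    exact (hi2.sub (hi1.const_mul _)).add (hi0.const_mul _)
  have hval : ∫ x, Real.exp (θ x) * (η x - c) ^ 2 ∂μ =
      (∫ x, Real.exp (θ x) * (η x * η x) ∂μ) - 2 * c * A + c ^ 2 * L := by
    have hi12 : Integrable
        (fun x => Real.exp (θ x) * (η x * η x) - 2 * c * (Real.exp (θ x) * η x)) μ :=
      hi2.sub (hi1.const_mul _)
    rw [hexp, integral_add hi12 (hi0.const_mul _),
      integral_sub hi2 (hi1.const_mul _), integral_const_mul, integral_const_mul]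
  have hpos : 0 < ∫ x, Real.exp (θ x) * (η x - c) ^ 2 ∂μ := by
    refine lt_of_le_of_ne (integral_nonneg fun x => by positivity) fun h0 => ?_
    rw [eq_comm, integral_eq_zero_iff_of_nonneg (fun x => by positivity) hint] at h0
    obtain ⟨v, hv⟩ : ∃ v, η v ≠ 0 := by
      by_contra! hall
      exact hη (ContinuousLinearMap.ext hall)
    -- the hyperplane `η = c`
    let H : AffineSubspace ℝ E := AffineSubspace.mk' ((c / η v) • v) η.ker
    have hH : ∀ x, x ∈ H ↔ η x = c := by
      intro x
      rw [AffineSubspace.mem_mk', vsub_eq_sub, LinearMap.mem_ker]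
      simp [div_mul_cancel₀ _ hv, sub_eq_zero]
    refine hμ.not_concentrated H (fun htop => ?_) ?_
    · have h1 : η 0 = c := (hH 0).1 (htop ▸ AffineSubspace.mem_top ℝ E _)
      have h2 : η v = c := (hH v).1 (htop ▸ AffineSubspace.mem_top ℝ E _)
      rw [map_zero] at h1
      exact hv (h2.trans h1.symm)
    · refine measure_mono_null (fun x hx => ?_) (ae_iff.1 h0)
      simp only [Pi.zero_apply, Set.mem_ofPred_eq]
      intro hx0
      refine hx ((hH x).2 ?_)
      simpa [Real.exp_ne_zero, sub_eq_zero] using hx0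
  rw [hval] at hpos
  have hfin : L⁻¹ * ∫ x, Real.exp (θ x) * (η x * η x) ∂μ - L⁻¹ ^ 2 * (A * A) =
      L⁻¹ * ((∫ x, Real.exp (θ x) * (η x * η x) ∂μ) - 2 * c * A + c ^ 2 * L) := by
    rw [hc]
    field_simp
    ring
  rw [hfin]
  exact mul_pos (inv_pos.2 hL) hpos

theorem IsBasis.ker_fderiv_cumulantDeriv (hμ : IsBasis μ) {θ : StrongDual ℝ E}
    (h : θ ∈ Theta μ) : (fderiv ℝ (cumulantDeriv μ) θ).ker = ⊥ := by
  refine LinearMap.ker_eq_bot'.2 fun η hη => ?_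
  by_contra hne
  have := hμ.fderiv_cumulantDeriv_pos h hne
  rw [show fderiv ℝ (cumulantDeriv μ) θ η = 0 from hη, map_zero] at this
  exact lt_irrefl _ this

theorem IsBasis.range_fderiv_cumulantDeriv (hμ : IsBasis μ) {θ : StrongDual ℝ E}
    (h : θ ∈ Theta μ) : (fderiv ℝ (cumulantDeriv μ) θ).range = ⊤ :=
  (LinearMap.ker_eq_bot_iff_range_eq_top_of_finrank_eq_finrank (finrank_strongDual E)).1
    (hμ.ker_fderiv_cumulantDeriv h)

theorem IsBasis.isOpen_meanDomain (hμ : IsBasis μ) : IsOpen (meanDomain μ) := by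
  rw [isOpen_iff_mem_nhds]
  rintro _ ⟨θ, hθ, rfl⟩
  rw [← (hμ.hasStrictFDerivAt_cumulantDeriv hθ).map_nhds_eq_of_surj
    (hμ.range_fderiv_cumulantDeriv hθ)]
  exact image_mem_map ((isOpen_Theta μ).mem_nhds hθ)

/-! ### Convexity of the cumulant function -/

/-- The domain of the Laplace transform is convex, by convexity of the exponential. -/
theorem convex_Theta (μ : Measure E) : Convex ℝ (Theta μ) := by
  refine Convex.interior fun θ hθ η hη a b ha hb hab => ?_
  have hi := ((integrable_exp_of_laplace_lt_top hθ).const_mul a).add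
    ((integrable_exp_of_laplace_lt_top hη).const_mul b)
  have hle : Integrable (fun x => Real.exp ((a • θ + b • η) x)) μ := by
    refine hi.mono' (by fun_prop) (ae_of_all _ fun x => ?_)
    rw [Real.norm_eq_abs, abs_of_pos (Real.exp_pos _)]
    exact convexOn_exp.2 (Set.mem_univ (θ x)) (Set.mem_univ (η x)) ha hb hab
  have := hle.2
  rwa [hasFiniteIntegral_iff_ofReal (ae_of_all _ fun x => (Real.exp_pos _).le)] at this

theorem IsBasis.cumulantDeriv_strictMono (hμ : IsBasis μ) {θ η : StrongDual ℝ E}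
    (hθ : θ ∈ Theta μ) (hη : η ∈ Theta μ) (hne : θ ≠ η) :
    (η - θ) (cumulantDeriv μ θ) < (η - θ) (cumulantDeriv μ η) := by
  have hseg : ∀ t ∈ Set.Icc (0 : ℝ) 1, θ + t • (η - θ) ∈ Theta μ := fun t ht =>
    (convex_Theta μ).add_smul_sub_mem hθ hη ht
  have hder : ∀ t ∈ Set.Icc (0 : ℝ) 1,
      HasDerivAt (fun t : ℝ => (η - θ) (cumulantDeriv μ (θ + t • (η - θ))))
        ((η - θ) (fderiv ℝ (cumulantDeriv μ) (θ + t • (η - θ)) (η - θ))) t := by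
    intro t ht
    have h1 : HasDerivAt (fun t : ℝ => θ + t • (η - θ)) (η - θ) t := by
      simpa using ((hasDerivAt_id t).smul_const (η - θ)).const_add θ
    have h2 := (hμ.hasStrictFDerivAt_cumulantDeriv (hseg t ht)).hasFDerivAt
    exact (η - θ).hasFDerivAt.comp_hasDerivAt t (HasFDerivAt.comp_hasDerivAt
      (l := cumulantDeriv μ) t h2 h1)
  have hmono := strictMonoOn_of_deriv_pos (convex_Icc (0 : ℝ) 1)
    (fun t ht => (hder t ht).continuousAt.continuousWithinAt) (fun t ht => by
      rw [(hder t (interior_subset ht)).deriv]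
      exact hμ.fderiv_cumulantDeriv_pos (hseg t (interior_subset ht)) (sub_ne_zero.2 hne.symm))
  simpa using hmono (Set.left_mem_Icc.2 zero_le_one) (Set.right_mem_Icc.2 zero_le_one) zero_lt_one

theorem IsBasis.injOn_cumulantDeriv (hμ : IsBasis μ) :
    Set.InjOn (cumulantDeriv μ) (Theta μ) := by
  intro θ hθ η hη heq
  by_contra hne
  have := hμ.cumulantDeriv_strictMono hθ hη hne
  rw [heq] at this
  exact lt_irrefl _ this

theorem IsBasis.psi_cumulantDeriv (hμ : IsBasis μ) {θ : StrongDual ℝ E} (h : θ ∈ Theta μ) :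
    psi μ (cumulantDeriv μ θ) = θ :=
  hμ.injOn_cumulantDeriv.leftInvOn_invFunOn h

theorem IsBasis.variance_cumulantDeriv (hμ : IsBasis μ) {θ : StrongDual ℝ E}
    (h : θ ∈ Theta μ) :
    variance μ (cumulantDeriv μ θ) = fderiv ℝ (cumulantDeriv μ) θ := by
  rw [variance, hμ.psi_cumulantDeriv h]

theorem IsBasis.variance_symm (hμ : IsBasis μ) {m : E} (hm : m ∈ meanDomain μ)
    (η ζ : StrongDual ℝ E) : ζ (variance μ m η) = η (variance μ m ζ) := by
  obtain ⟨θ, hθ, rfl⟩ := hm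
  rw [hμ.variance_cumulantDeriv hθ]
  exact hμ.fderiv_cumulantDeriv_symm hθ η ζ

/-- The cumulant function lies above its tangent planes. -/
theorem IsBasis.cumulant_add_le (hμ : IsBasis μ) {θ η : StrongDual ℝ E}
    (hθ : θ ∈ Theta μ) (hη : η ∈ Theta μ) :
    cumulant μ θ + (η - θ) (cumulantDeriv μ θ) ≤ cumulant μ η := by
  have hseg : ∀ t ∈ Set.Icc (0 : ℝ) 1, θ + t • (η - θ) ∈ Theta μ := fun t ht =>
    (convex_Theta μ).add_smul_sub_mem hθ hη ht
  have hder : ∀ t ∈ Set.Icc (0 : ℝ) 1,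
      HasDerivAt (fun t : ℝ => cumulant μ (θ + t • (η - θ)))
        ((η - θ) (cumulantDeriv μ (θ + t • (η - θ)))) t := by
    intro t ht
    have h1 : HasDerivAt (fun t : ℝ => θ + t • (η - θ)) (η - θ) t := by
      simpa using ((hasDerivAt_id t).smul_const (η - θ)).const_add θ
    exact (hμ.hasFDerivAt_cumulant (hseg t ht)).comp_hasDerivAt t h1
  obtain ⟨t, ht, heq⟩ := exists_hasDerivAt_eq_slope
    (fun t : ℝ => cumulant μ (θ + t • (η - θ))) _ zero_lt_one
    (fun t ht => (hder t ht).continuousAt.continuousWithinAt)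
    fun t ht => hder t (Set.Ioo_subset_Icc_self ht)
  simp only [one_smul, add_sub_cancel, zero_smul, add_zero, sub_zero, div_one] at heq
  rcases eq_or_ne θ η with rfl | hne
  · simp
  have hmono := hμ.cumulantDeriv_strictMono hθ (hseg t (Set.Ioo_subset_Icc_self ht)) (by
    simp [ht.1.ne', sub_ne_zero.2 hne.symm])
  rw [add_sub_cancel_left, smul_apply, smul_apply, smul_eq_mul, smul_eq_mul,
    mul_lt_mul_iff_right₀ ht.1] at hmono
  linarith

/-- Around the point where `k'_μ = m₀`, the function `k_μ - ⟨·, m₀⟩` grows at least linearly: it is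
convex and its gradient points outwards on a small sphere. -/
theorem IsBasis.exists_linear_growth (hμ : IsBasis μ) {θ₀ : StrongDual ℝ E}
    (h₀ : θ₀ ∈ Theta μ) :
    ∃ c > 0, ∃ d : ℝ, ∀ θ ∈ Theta μ,
      c * ‖θ‖ - d ≤ cumulant μ θ - θ (cumulantDeriv μ θ₀) := by
  obtain ⟨r, hr, hball⟩ := Metric.nhds_basis_closedBall.mem_iff.1 ((isOpen_Theta μ).mem_nhds h₀)
  have hsph : Metric.sphere θ₀ r ⊆ Theta μ := Metric.sphere_subset_closedBall.trans hball
  obtain ⟨ε, hε, hmin⟩ := (isCompact_sphere θ₀ r).exists_forall_le'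
    (f := fun η => (η - θ₀) (cumulantDeriv μ η - cumulantDeriv μ θ₀)) (a := 0)
    (ContinuousOn.clm_apply (by fun_prop)
      ((hμ.continuousOn_cumulantDeriv.mono hsph).sub continuousOn_const)) (fun η hη => by
      have hne : θ₀ ≠ η := by
        rintro rfl
        simp at hη
        exact hr.ne hη
      rw [map_sub, sub_pos]
      exact hμ.cumulantDeriv_strictMono h₀ (hsph hη) hne)
  set m₀ := cumulantDeriv μ θ₀
  have hlow : ∀ θ ∈ Theta μ, cumulant μ θ₀ - θ₀ m₀ ≤ cumulant μ θ - θ m₀ := by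
    intro θ hθ
    have := hμ.cumulant_add_le h₀ hθ
    rw [sub_apply] at this
    linarith
  refine ⟨ε / r, by positivity, ε / r * (‖θ₀‖ + r) - (cumulant μ θ₀ - θ₀ m₀), fun θ hθ => ?_⟩
  have hnorm : ‖θ‖ ≤ ‖θ - θ₀‖ + ‖θ₀‖ := by simpa using norm_add_le (θ - θ₀) θ₀
  have hfin : ε / r * (‖θ - θ₀‖ - r) ≤ (cumulant μ θ - θ m₀) - (cumulant μ θ₀ - θ₀ m₀) := by
    rcases le_or_gt ‖θ - θ₀‖ r with hle | hgt
    · have h1 : ε / r * (‖θ - θ₀‖ - r) ≤ 0 :=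
        mul_nonpos_of_nonneg_of_nonpos (by positivity) (by linarith)
      linarith [hlow θ hθ]
    · have hN : 0 < ‖θ - θ₀‖ := hr.trans hgt
      -- the point of the sphere on the way from `θ₀` to `θ`
      set η := θ₀ + (r / ‖θ - θ₀‖) • (θ - θ₀) with hη
      have hηs : η ∈ Metric.sphere θ₀ r := by
        rw [mem_sphere_iff_norm, hη, add_sub_cancel_left, norm_smul, Real.norm_eq_abs,
          abs_of_pos (by positivity), div_mul_cancel₀ _ hN.ne']
      have hdir : θ - η = ((‖θ - θ₀‖ - r) / r) • (η - θ₀) := by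
        rw [hη, add_sub_cancel_left, smul_smul, ← sub_sub]
        have : (‖θ - θ₀‖ - r) / r * (r / ‖θ - θ₀‖) = 1 - r / ‖θ - θ₀‖ := by
          field_simp
        rw [this]
        module
      have h1 := hμ.cumulant_add_le (hsph hηs) hθ
      have h2 := hlow η (hsph hηs)
      have h3 : ε * ((‖θ - θ₀‖ - r) / r) ≤ (θ - η) (cumulantDeriv μ η - m₀) := by
        rw [hdir, smul_apply, smul_eq_mul, mul_comm]
        exact mul_le_mul_of_nonneg_left (hmin η hηs) (div_nonneg (by linarith) hr.le)
      rw [map_sub, sub_apply θ η m₀] at h3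
      have h4 : ε / r * (‖θ - θ₀‖ - r) = ε * ((‖θ - θ₀‖ - r) / r) := by ring
      linarith
  have h5 : ε / r * ‖θ‖ ≤ ε / r * (‖θ - θ₀‖ + ‖θ₀‖) :=
    mul_le_mul_of_nonneg_left hnorm (by positivity)
  linarith

end Cumulant

/-! ### The divergence of the variance function -/

section DualBasis

variable {E : Type*} [NormedAddCommGroup E] [NormedSpace ℝ E] [FiniteDimensional ℝ E] {n : ℕ}

theorem dualBasisVec_apply (e : Module.Basis (Fin n) ℝ E) (i : Fin n) (x : E) :
    dualBasisVec e i x = e.repr x i := rfl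

theorem dualBasisVec_self (e : Module.Basis (Fin n) ℝ E) (i : Fin n) :
    dualBasisVec e i (e i) = 1 := by
  rw [dualBasisVec_apply, e.repr_self, Finsupp.single_eq_same]

theorem sum_dualBasisVec_smul (e : Module.Basis (Fin n) ℝ E) (x : E) :
    ∑ i, dualBasisVec e i x • e i = x := e.sum_repr x

theorem sum_smul_dualBasisVec (e : Module.Basis (Fin n) ℝ E) (η : StrongDual ℝ E) :
    ∑ i, η (e i) • dualBasisVec e i = η := by
  ext x
  conv_rhs => rw [← sum_dualBasisVec_smul e x]
  simp [mul_comm]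

/-- The contraction `∑ᵢ B(eᵢ) eᵢ*` does not depend on the basis. -/
theorem sum_apply_dualBasisVec_eq (e f : Module.Basis (Fin n) ℝ E)
    (B : E →ₗ[ℝ] (StrongDual ℝ E →L[ℝ] E)) :
    ∑ i, B (e i) (dualBasisVec e i) = ∑ j, B (f j) (dualBasisVec f j) := by
  calc ∑ i, B (e i) (dualBasisVec e i)
      = ∑ i, ∑ j, dualBasisVec f j (e i) • B (f j) (dualBasisVec e i) := by
        refine Finset.sum_congr rfl fun i _ => ?_
        conv_lhs => rw [← sum_dualBasisVec_smul f (e i)]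
        simp
    _ = ∑ j, B (f j) (dualBasisVec f j) := by
        rw [Finset.sum_comm]
        refine Finset.sum_congr rfl fun j _ => ?_
        conv_rhs => rw [← sum_smul_dualBasisVec e (dualBasisVec f j)]
        simp

end DualBasis

section CubicForm

variable {E : Type*} [NormedAddCommGroup E] [NormedSpace ℝ E] [FiniteDimensional ℝ E]

/-- The affine part `B(m) + (1 + ⟨β, m⟩) C` of the homogenized quadratic variance function. -/
noncomputable def affinePart (B : E →ₗ[ℝ] (StrongDual ℝ E →L[ℝ] E)) (C : StrongDual ℝ E →L[ℝ] E)
    (β : StrongDual ℝ E) (m : E) : StrongDual ℝ E →L[ℝ] E :=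
  B m + (1 + β m) • C

theorem affinePart_apply (B : E →ₗ[ℝ] (StrongDual ℝ E →L[ℝ] E)) (C : StrongDual ℝ E →L[ℝ] E)
    (β : StrongDual ℝ E) (m : E) (θ : StrongDual ℝ E) :
    affinePart B C β m θ = B m θ + (1 + β m) • C θ := rfl

/-- The polynomial map, of degree at most three, that the variance function of a simple cubic
family is on the domain of the means:
`(1 + ⟨β, m⟩) q m ⊗ m + (I + m ⊗ β) (B(m) + (1 + ⟨β, m⟩) C) (I + β ⊗ m)`. -/
noncomputable def cubicForm (q : ℝ) (B : E →ₗ[ℝ] (StrongDual ℝ E →L[ℝ] E))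
    (C : StrongDual ℝ E →L[ℝ] E) (β : StrongDual ℝ E) (m : E) : StrongDual ℝ E →L[ℝ] E :=
  (q * (1 + β m)) • tensorSelf m +
    (ContinuousLinearMap.id ℝ E + tensorRight m β) ∘L affinePart B C β m ∘L
      (ContinuousLinearMap.id ℝ (StrongDual ℝ E) + tensorLeft β m)

variable (q : ℝ) (B : E →ₗ[ℝ] (StrongDual ℝ E →L[ℝ] E)) (C : StrongDual ℝ E →L[ℝ] E)
  (β : StrongDual ℝ E)

theorem cubicForm_apply (m : E) (θ : StrongDual ℝ E) :
    cubicForm q B C β m θ = (q * (1 + β m) * θ m) • m + affinePart B C β m θ +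
      θ m • affinePart B C β m β +
      (β (affinePart B C β m θ) + θ m * β (affinePart B C β m β)) • m := by
  have h1 : tensorSelf m θ = θ m • m := rfl
  have h2 : ∀ x, tensorRight m β x = β x • m := fun _ => rfl
  have h3 : tensorLeft β m θ = θ m • β := rfl
  simp only [cubicForm, add_apply, smul_apply, ContinuousLinearMap.comp_apply,
    ContinuousLinearMap.id_apply, h1, h2, h3, map_add, map_smul]
  module

theorem smul_conj_quadratic_eq_cubicForm {m : E} (hm : 1 + β m ≠ 0) :
    (1 + β m) • ((ContinuousLinearMap.id ℝ E + tensorRight m β) ∘L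
        (q • tensorSelf ((1 + β m)⁻¹ • m) + B ((1 + β m)⁻¹ • m) + C) ∘L
          (ContinuousLinearMap.id ℝ (StrongDual ℝ E) + tensorLeft β m)) =
      cubicForm q B C β m := by
  ext1 θ
  have h1 : ∀ (x : E) (η : StrongDual ℝ E), tensorSelf x η = η x • x := fun _ _ => rfl
  have h2 : ∀ x, tensorRight m β x = β x • m := fun _ => rfl
  have h3 : tensorLeft β m θ = θ m • β := rfl
  rw [cubicForm_apply]
  simp only [affinePart_apply, add_apply, smul_apply, ContinuousLinearMap.comp_apply,
    ContinuousLinearMap.id_apply, h1, h2, h3, map_add, map_smul, smul_eq_mul]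
  match_scalars <;> field_simp
  ring

theorem hasFDerivAt_affinePart_apply (m : E) (θ : StrongDual ℝ E) :
    HasFDerivAt (fun m => affinePart B C β m θ)
      ((ContinuousLinearMap.apply ℝ E θ) ∘L (LinearMap.toContinuousLinearMap B) +
        β.smulRight (C θ)) m := by
  have h1 := ((ContinuousLinearMap.apply ℝ E θ) ∘L
    (LinearMap.toContinuousLinearMap B)).hasFDerivAt (x := m)
  have h2 := (β.hasFDerivAt (x := m)).const_add 1 |>.smul_const (C θ)
  exact h1.add h2

theorem exists_hasFDerivAt_cubicForm_apply (m : E) (θ : StrongDual ℝ E) :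
    ∃ D : E →L[ℝ] E, HasFDerivAt (fun m => cubicForm q B C β m θ) D m ∧ ∀ h, D h =
      (q * β h * θ m + q * (1 + β m) * θ h) • m + (q * (1 + β m) * θ m) • h +
      (B h θ + β h • C θ) + θ h • affinePart B C β m β + θ m • (B h β + β h • C β) +
      (β (B h θ) + β h * β (C θ) + θ h * β (affinePart B C β m β) +
        θ m * (β (B h β) + β h * β (C β))) • m +
      (β (affinePart B C β m θ) + θ m * β (affinePart B C β m β)) • h := by
  have hθ := θ.hasFDerivAt (x := m)
  have hs := ((β.hasFDerivAt (x := m)).const_add 1).const_mul q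
  have hm := hasFDerivAt_id (𝕜 := ℝ) m
  have hW := hasFDerivAt_affinePart_apply B C β m θ
  have hWβ := hasFDerivAt_affinePart_apply B C β m β
  have hβW : HasFDerivAt (fun m => β (affinePart B C β m θ)) _ m := β.hasFDerivAt.comp m hW
  have hβWβ : HasFDerivAt (fun m => β (affinePart B C β m β)) _ m := β.hasFDerivAt.comp m hWβ
  refine ⟨_, ((((hs.mul hθ).smul hm).add hW |>.add (hθ.smul hWβ)).add
    ((hβW.add (hθ.mul hβWβ)).smul hm)).congr_of_eventuallyEq
      (Eventually.of_forall fun x => cubicForm_apply q B C β x θ), fun h => ?_⟩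
  simp only [add_apply, smul_apply, ContinuousLinearMap.comp_apply,
    ContinuousLinearMap.smulRight_apply, ContinuousLinearMap.id_apply,
    ContinuousLinearMap.apply_apply, LinearMap.coe_toContinuousLinearMap', map_add, map_smul,
    smul_eq_mul, id, Pi.add_apply, Pi.mul_apply]
  module

theorem differentiable_cubicForm : Differentiable ℝ (cubicForm q B C β) := by
  refine ContDiff.differentiable (n := 1) (contDiff_clm_apply_iff.2 fun θ => ?_) one_ne_zero
  have hB : ∀ η : StrongDual ℝ E, ContDiff ℝ 1 fun m => B m η := fun η =>
    ((ContinuousLinearMap.apply ℝ E η) ∘L (LinearMap.toContinuousLinearMap B)).contDiff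
  have hBθ := hB θ
  have hBβ := hB β
  simp only [cubicForm_apply, affinePart_apply]
  fun_prop

theorem fderiv_cubicForm_apply (m h : E) (θ : StrongDual ℝ E) :
    fderiv ℝ (cubicForm q B C β) m h θ =
      (q * β h * θ m + q * (1 + β m) * θ h) • m + (q * (1 + β m) * θ m) • h +
      (B h θ + β h • C θ) + θ h • affinePart B C β m β + θ m • (B h β + β h • C β) +
      (β (B h θ) + β h * β (C θ) + θ h * β (affinePart B C β m β) +
        θ m * (β (B h β) + β h * β (C β))) • m +
      (β (affinePart B C β m θ) + θ m * β (affinePart B C β m β)) • h := by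
  obtain ⟨D, hD, hf⟩ := exists_hasFDerivAt_cubicForm_apply q B C β m θ
  have h1 := ((differentiable_cubicForm q B C β m).hasFDerivAt.clm_apply
    (hasFDerivAt_const θ m)).unique hD
  rw [← hf, ← h1]
  simp

/-- The divergence of the cubic form; only the symmetry of its affine part at `m` is used. -/
theorem sum_fderiv_cubicForm {n : ℕ} (e : Module.Basis (Fin n) ℝ E) {m : E} (hm : 1 + β m ≠ 0)
    (hsymm : ∀ η : StrongDual ℝ E, β (affinePart B C β m η) = η (affinePart B C β m β)) :
    ∑ i, fderiv ℝ (cubicForm q B C β) m (e i) (dualBasisVec e i) =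
      (((n : ℝ) + 2) / (1 + β m)) • cubicForm q B C β m β + ∑ i, B (e i) (dualBasisVec e i) +
        (((n : ℝ) + 1) * q + β (∑ i, B (e i) (dualBasisVec e i))) • m := by
  set a := ∑ i, B (e i) (dualBasisVec e i) with ha
  set W := affinePart B C β m β with hW
  have hm' := sum_dualBasisVec_smul e m
  have hβm : ∑ i, β (e i) * dualBasisVec e i m = β m := by
    conv_rhs => rw [← hm']
    simp [mul_comm]
  have hβm' : ∑ i, dualBasisVec e i m * β (e i) = β m := by
    simp_rw [← hβm, mul_comm]
  have hone : ∑ i, dualBasisVec e i (e i) = (n : ℝ) := by simp [dualBasisVec_self]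
  have hC : ∑ i, β (e i) • C (dualBasisVec e i) = C β := by
    conv_rhs => rw [← sum_smul_dualBasisVec e β]
    simp
  have hβC : ∑ i, β (e i) * β (C (dualBasisVec e i)) = β (C β) := by
    rw [← hC]
    simp
  have hB : ∑ i, dualBasisVec e i m • B (e i) β = B m β := by
    conv_rhs => rw [← hm']
    simp
  have hβB : ∑ i, dualBasisVec e i m * β (B (e i) β) = β (B m β) := by
    rw [← hB]
    simp
  have hβa : ∑ i, β (B (e i) (dualBasisVec e i)) = β a := by rw [ha, map_sum]
  have hWs : ∑ i, dualBasisVec e i W • e i = W := sum_dualBasisVec_smul e W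
  have hWB : B m β = W - (1 + β m) • C β := by
    rw [hW, affinePart_apply, add_sub_cancel_right]
  calc ∑ i, fderiv ℝ (cubicForm q B C β) m (e i) (dualBasisVec e i)
      = ∑ i, ((q * (β (e i) * dualBasisVec e i m) + q * (1 + β m) * dualBasisVec e i (e i)) • m +
          (q * (1 + β m)) • (dualBasisVec e i m • e i) +
          (B (e i) (dualBasisVec e i) + β (e i) • C (dualBasisVec e i)) +
          dualBasisVec e i (e i) • W +
          (dualBasisVec e i m • B (e i) β + (dualBasisVec e i m * β (e i)) • C β) +
          (β (B (e i) (dualBasisVec e i)) + β (e i) * β (C (dualBasisVec e i)) +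
            dualBasisVec e i (e i) * β W + (dualBasisVec e i m * β (B (e i) β) +
              dualBasisVec e i m * β (e i) * β (C β))) • m +
          (dualBasisVec e i W • e i + β W • (dualBasisVec e i m • e i))) := by
        refine Finset.sum_congr rfl fun i _ => ?_
        rw [fderiv_cubicForm_apply, hsymm (dualBasisVec e i), ← hW]
        module
    _ = (q * β m + q * (1 + β m) * n) • m + (q * (1 + β m)) • m + (a + C β) + (n : ℝ) • W +
          (B m β + β m • C β) +
          (β a + β (C β) + n * β W + (β (B m β) + β m * β (C β))) • m + (W + β W • m) := by
        simp only [Finset.sum_add_distrib, ← Finset.sum_smul, ← Finset.smul_sum,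
          ← Finset.mul_sum, ← Finset.sum_mul, hβm, hβm', hone, hC, hβC, hB, hβB, hβa, hWs, hm', ← ha]
    _ = _ := by
        rw [cubicForm_apply, ← hW, hWB, map_sub, map_smul, smul_eq_mul]
        match_scalars <;> field_simp <;> ring

end CubicForm

section SimpleCubic

variable {E : Type*} [NormedAddCommGroup E] [NormedSpace ℝ E] [FiniteDimensional ℝ E]
  [MeasurableSpace E] [BorelSpace E] {μ : Measure E} {β : StrongDual ℝ E}

theorem IsSimpleCubic.one_add_pos (hF : IsSimpleCubic μ β) {m : E} (hm : m ∈ meanDomain μ) :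
    0 < 1 + β m := by
  obtain ⟨-, ν, -, h⟩ := hF
  exact (h m hm).1

theorem IsSimpleCubic.exists_variance_eq_cubicForm (hF : IsSimpleCubic μ β) :
    ∃ (q : ℝ) (B : E →ₗ[ℝ] (StrongDual ℝ E →L[ℝ] E)) (C : StrongDual ℝ E →L[ℝ] E),
      ∀ m ∈ meanDomain μ, variance μ m = cubicForm q B C β m ∧
        ∀ η ζ : StrongDual ℝ E, ζ (affinePart B C β m η) = η (affinePart B C β m ζ) := by
  obtain ⟨-, ν, ⟨hν, q, B, C, hq⟩, h⟩ := hF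
  refine ⟨q, B, C, fun m hm => ?_⟩
  obtain ⟨hpos, hmem, hV⟩ := h m hm
  refine ⟨?_, fun η ζ => ?_⟩
  · rw [hV, hq _ hmem, smul_conj_quadratic_eq_cubicForm q B C β hpos.ne']
  · have hs := hν.variance_symm hmem η ζ
    have h1 : ∀ (x : E) (η : StrongDual ℝ E), tensorSelf x η = η x • x := fun _ _ => rfl
    simp only [hq _ hmem, add_apply, smul_apply, h1, map_add, map_smul, smul_eq_mul] at hs
    simp only [affinePart_apply, map_add, map_smul, smul_eq_mul]
    field_simp at hs
    exact mul_left_cancel₀ hpos.ne' (by linarith)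

theorem IsSimpleCubic.differentiableAt_variance (hF : IsSimpleCubic μ β) {m : E}
    (hm : m ∈ meanDomain μ) : DifferentiableAt ℝ (variance μ) m := by
  obtain ⟨q, B, C, h⟩ := hF.exists_variance_eq_cubicForm
  refine (differentiable_cubicForm q B C β m).congr_of_eventuallyEq ?_
  filter_upwards [hF.1.isOpen_meanDomain.mem_nhds hm] with x hx using (h x hx).1

theorem IsSimpleCubic.varianceEquation (hF : IsSimpleCubic μ β) :
    VarianceEquationProperty μ β := by
  obtain ⟨q, B, C, h⟩ := hF.exists_variance_eq_cubicForm
  set e₀ := Module.finBasis ℝ E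
  refine ⟨∑ i, B (e₀ i) (dualBasisVec e₀ i), ((Module.finrank ℝ E : ℝ) + 1) * q +
    β (∑ i, B (e₀ i) (dualBasisVec e₀ i)), fun m hm =>
    ⟨hF.differentiableAt_variance hm, fun e => ?_⟩⟩
  have heq : variance μ =ᶠ[𝓝 m] cubicForm q B C β := by
    filter_upwards [hF.1.isOpen_meanDomain.mem_nhds hm] with x hx using (h x hx).1
  rw [heq.fderiv_eq, (h m hm).1, sum_apply_dualBasisVec_eq e₀ e]
  exact sum_fderiv_cubicForm q B C β e (hF.one_add_pos hm).ne' fun η => (h m hm).2 η β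

end SimpleCubic

/-! ### The Hessian determinant -/

section Jacobi

variable {X : Type*} [NormedAddCommGroup X] [NormedSpace ℝ X] {ι : Type*} [Fintype ι]
  [DecidableEq ι]

/-- Jacobi's formula for the derivative of a determinant. -/
theorem hasFDerivAt_det {A : X → Matrix ι ι ℝ} {A' : ι → ι → X →L[ℝ] ℝ} {x : X}
    (h : ∀ i j, HasFDerivAt (fun x => A x i j) (A' i j) x) :
    HasFDerivAt (fun x => (A x).det) (∑ j, ∑ i, (A x).adjugate j i • A' i j) x := by
  have h1 : HasFDerivAt (fun x => (A x).det)
      (∑ σ : Equiv.Perm ι, ((Equiv.Perm.sign σ : ℤ) : ℝ) •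
        ∑ j, (∏ k ∈ Finset.univ.erase j, A x (σ k) k) • A' (σ j) j) x := by
    simp only [Matrix.det_apply']
    exact HasFDerivAt.fun_sum fun σ _ =>
      (HasFDerivAt.finsetProd (u := Finset.univ) fun j _ => h (σ j) j).const_mul _
  refine h1.congr_fderiv ?_
  ext v
  have h4 : ∀ j, ∑ i, (A x).adjugate j i * A' i j v =
      ((A x).updateCol j fun i => A' i j v).det := by
    intro j
    rw [← Matrix.cramer_apply, Matrix.cramer_eq_adjugate_mulVec]
    rfl
  have h5 : ∀ j, ((A x).updateCol j fun i => A' i j v).det = ∑ σ : Equiv.Perm ι,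
      ((Equiv.Perm.sign σ : ℤ) : ℝ) *
        ((∏ k ∈ Finset.univ.erase j, A x (σ k) k) * A' (σ j) j v) := by
    intro j
    rw [Matrix.det_apply']
    refine Finset.sum_congr rfl fun σ _ => ?_
    rw [← Finset.prod_erase_mul _ _ (Finset.mem_univ j), Matrix.updateCol_self]
    congr 2
    exact Finset.prod_congr rfl fun k hk => Matrix.updateCol_ne (Finset.ne_of_mem_erase hk)
  simp only [FunLike.coe_sum, Finset.sum_apply, smul_apply, smul_eq_mul, h4, h5]
  rw [Finset.sum_comm]
  simp only [Finset.mul_sum]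

end Jacobi

section MongeAmpere

variable {E : Type*} [NormedAddCommGroup E] [NormedSpace ℝ E] [FiniteDimensional ℝ E]
  [MeasurableSpace E] [BorelSpace E] {μ : Measure E} {β : StrongDual ℝ E} {n : ℕ}

theorem IsBasis.detIn_pos (hμ : IsBasis μ) (e : Module.Basis (Fin n) ℝ E)
    {θ : StrongDual ℝ E} (h : θ ∈ Theta μ) :
    0 < detIn e (fderiv ℝ (cumulantDeriv μ) θ) := by
  refine Matrix.PosDef.det_pos (Matrix.posDef_iff_dotProduct_mulVec.2 ⟨?_, fun x hx => ?_⟩)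
  · ext i j
    simp only [Matrix.conjTranspose_apply, Matrix.of_apply, star_trivial]
    exact hμ.fderiv_cumulantDeriv_symm h _ _
  · set η : StrongDual ℝ E := ∑ i, x i • dualBasisVec e i with hη
    have hηe : ∀ i, η (e i) = x i := by
      intro i
      simp [hη, dualBasisVec_apply, Finsupp.single_apply]
    have hne : η ≠ 0 := by
      intro h0
      refine hx (funext fun i => ?_)
      rw [← hηe, h0]
      rfl
    have := hμ.fderiv_cumulantDeriv_pos h hne
    refine this.trans_eq ?_
    simp only [dotProduct, Matrix.mulVec, Matrix.of_apply, star_trivial, hη, map_sum, map_smul,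
      FunLike.coe_sum, Finset.sum_apply, smul_apply, smul_eq_mul, Finset.mul_sum]
    rw [Finset.sum_comm]
    refine Finset.sum_congr rfl fun i _ => Finset.sum_congr rfl fun j _ => ?_
    ring

theorem IsBasis.hasFDerivAt_fderiv_cumulantDeriv (hμ : IsBasis μ) {θ : StrongDual ℝ E}
    (h : θ ∈ Theta μ) (hV : DifferentiableAt ℝ (variance μ) (cumulantDeriv μ θ)) :
    HasFDerivAt (fderiv ℝ (cumulantDeriv μ))
      (fderiv ℝ (variance μ) (cumulantDeriv μ θ) ∘L fderiv ℝ (cumulantDeriv μ) θ) θ := by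
  have h1 := (hμ.hasStrictFDerivAt_cumulantDeriv h).hasFDerivAt
  refine (HasFDerivAt.comp (g := variance μ) θ hV.hasFDerivAt h1).congr_of_eventuallyEq ?_
  filter_upwards [(isOpen_Theta μ).mem_nhds h] with η hη
  exact (hμ.variance_cumulantDeriv hη).symm

theorem IsBasis.fderiv_variance_symm (hμ : IsBasis μ) {m : E} (hm : m ∈ meanDomain μ)
    (hV : DifferentiableAt ℝ (variance μ) m) (x : E) (η ζ : StrongDual ℝ E) :
    ζ (fderiv ℝ (variance μ) m x η) = η (fderiv ℝ (variance μ) m x ζ) := by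
  have h1 : ∀ η ζ : StrongDual ℝ E, HasFDerivAt (fun m => ζ (variance μ m η))
      (ζ ∘L (fderiv ℝ (variance μ) m).flip η) m := by
    intro η ζ
    refine ζ.hasFDerivAt.comp m ((hV.hasFDerivAt.clm_apply (hasFDerivAt_const η m)).congr_fderiv ?_)
    ext
    simp
  have h2 : HasFDerivAt (fun m => ζ (variance μ m η)) (η ∘L (fderiv ℝ (variance μ) m).flip ζ) m := by
    refine (h1 ζ η).congr_of_eventuallyEq ?_
    filter_upwards [hμ.isOpen_meanDomain.mem_nhds hm] with x hx using hμ.variance_symm hx η ζ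
  exact congrArg (fun T => T x) ((h1 η ζ).unique h2)

/-- The logarithmic derivative of the Hessian determinant is the divergence of the variance
function: by the symmetry of third derivatives, `V⁻¹ k'''(h)` and `x ↦ V'(m)(x) h` have the same
trace. -/
theorem IsBasis.hasFDerivAt_log_detIn (hμ : IsBasis μ) (e : Module.Basis (Fin n) ℝ E)
    {θ : StrongDual ℝ E} (h : θ ∈ Theta μ)
    (hV : DifferentiableAt ℝ (variance μ) (cumulantDeriv μ θ)) :
    HasFDerivAt (fun θ => Real.log (detIn e (fderiv ℝ (cumulantDeriv μ) θ)))
      (bidual E (∑ i, fderiv ℝ (variance μ) (cumulantDeriv μ θ) (e i) (dualBasisVec e i))) θ := by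
  set m := cumulantDeriv μ θ with hm
  set V' := fderiv ℝ (variance μ) m
  set K := fderiv ℝ (cumulantDeriv μ) θ with hK
  have hD := hμ.hasFDerivAt_fderiv_cumulantDeriv h hV
  have hthird : ∀ η ζ : StrongDual ℝ E, V' (K η) ζ = V' (K ζ) η :=
    second_derivative_symmetric_of_eventually (f := cumulantDeriv μ) (by
      filter_upwards [(isOpen_Theta μ).mem_nhds h] with ξ hξ
      exact (hμ.hasStrictFDerivAt_cumulantDeriv hξ).hasFDerivAt) hD
  set A : StrongDual ℝ E → Matrix (Fin n) (Fin n) ℝ := fun θ => Matrix.of fun i j =>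
    dualBasisVec e i (fderiv ℝ (cumulantDeriv μ) θ (dualBasisVec e j)) with hA
  have hentry : ∀ i j, HasFDerivAt (fun θ => A θ i j)
      (dualBasisVec e i ∘L (V' ∘L K).flip (dualBasisVec e j)) θ := by
    intro i j
    refine (dualBasisVec e i).hasFDerivAt.comp θ
      ((hD.clm_apply (hasFDerivAt_const (dualBasisVec e j) θ)).congr_fderiv ?_)
    ext
    simp [V', K, m]
  have hpos : 0 < (A θ).det := hμ.detIn_pos e h
  refine ((hasFDerivAt_det hentry).log hpos.ne').congr_fderiv ?_
  ext η
  have hKe : ∀ j, K (dualBasisVec e j) = ∑ l, A θ l j • e l := fun j =>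
    (sum_dualBasisVec_smul e _).symm
  have hcalc : ∑ j, ∑ i, (A θ).adjugate j i * dualBasisVec e i (V' (K η) (dualBasisVec e j)) =
      (A θ).det * ∑ i, dualBasisVec e i (V' (e i) η) := by
    calc ∑ j, ∑ i, (A θ).adjugate j i * dualBasisVec e i (V' (K η) (dualBasisVec e j))
        = ∑ j, ∑ i, ∑ l, (A θ l j * (A θ).adjugate j i) * dualBasisVec e i (V' (e l) η) := by
          refine Finset.sum_congr rfl fun j _ => Finset.sum_congr rfl fun i _ => ?_
          rw [hthird, hKe]
          simp only [map_sum, map_smul, FunLike.coe_sum, Finset.sum_apply, smul_apply,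
            smul_eq_mul, Finset.mul_sum]
          refine Finset.sum_congr rfl fun l _ => ?_
          ring
      _ = ∑ i, ∑ l, (A θ * (A θ).adjugate) l i * dualBasisVec e i (V' (e l) η) := by
          rw [Finset.sum_comm]
          refine Finset.sum_congr rfl fun i _ => ?_
          rw [Finset.sum_comm]
          refine Finset.sum_congr rfl fun l _ => ?_
          rw [Matrix.mul_apply, Finset.sum_mul]
      _ = _ := by
          rw [Matrix.mul_adjugate, Finset.mul_sum]
          refine Finset.sum_congr rfl fun i _ => ?_
          simp [Matrix.one_apply]
  simp only [FunLike.coe_sum, Finset.sum_apply, smul_apply, smul_eq_mul, bidual_apply, map_sum,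
    ContinuousLinearMap.comp_apply, ContinuousLinearMap.flip_apply, hcalc]
  rw [← mul_assoc, inv_mul_cancel₀ hpos.ne', one_mul]
  exact Finset.sum_congr rfl fun i _ => hμ.fderiv_variance_symm ⟨θ, h, rfl⟩ hV _ _ _

/-- Integration of the variance equation: both sides of the logarithm of the Monge-Ampère equation
have the same derivative on the convex set `Θ(μ)`. -/
theorem IsSimpleCubic.mongeAmpere (hF : IsSimpleCubic μ β) : MongeAmpereProperty μ β := by
  obtain ⟨a, b, hab⟩ := hF.varianceEquation
  rw [MongeAmpereProperty]
  set n := Module.finrank ℝ E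
  refine ⟨a, b, fun e => ?_⟩
  have hμ := hF.1
  obtain ⟨θ₀, hθ₀⟩ := hμ.nonempty
  set g : StrongDual ℝ E → ℝ := fun θ => Real.log (detIn e (fderiv ℝ (cumulantDeriv μ) θ)) -
    (((n : ℝ) + 2) * Real.log (1 + β (cumulantDeriv μ θ)) + (θ a + b * cumulant μ θ)) with hg
  have hpos : ∀ θ ∈ Theta μ, 0 < 1 + β (cumulantDeriv μ θ) := fun θ hθ =>
    hF.one_add_pos ⟨θ, hθ, rfl⟩
  have hder : ∀ θ ∈ Theta μ, HasFDerivAt g (0 : StrongDual ℝ E →L[ℝ] ℝ) θ := by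
    intro θ hθ
    obtain ⟨hV, heq⟩ := hab _ ⟨θ, hθ, rfl⟩
    have h1 := hμ.hasFDerivAt_log_detIn e hθ hV
    have h2 : HasFDerivAt (fun θ => β (cumulantDeriv μ θ))
        (β ∘L fderiv ℝ (cumulantDeriv μ) θ) θ :=
      β.hasFDerivAt.comp θ (hμ.hasStrictFDerivAt_cumulantDeriv hθ).hasFDerivAt
    have h3 := ((h2.const_add 1).log (hpos θ hθ).ne').const_mul ((n : ℝ) + 2)
    have h4 : HasFDerivAt (fun θ : StrongDual ℝ E => θ a) (bidual E a) θ :=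
      (bidual E a).hasFDerivAt
    refine (h1.sub (h3.add (h4.add ((hμ.hasFDerivAt_cumulant hθ).const_mul b)))).congr_fderiv ?_
    rw [heq e, hμ.variance_cumulantDeriv hθ]
    ext η
    simp only [sub_apply, add_apply, smul_apply, bidual_apply, smul_eq_mul, map_add, map_smul,
      ContinuousLinearMap.comp_apply, zero_apply, hμ.fderiv_cumulantDeriv_symm hθ β η]
    ring
  have hconst : ∀ θ ∈ Theta μ, g θ = g θ₀ := fun θ hθ =>
    (isOpen_Theta μ).is_const_of_fderiv_eq_zero (convex_Theta μ).isPreconnected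
      (fun η hη => (hder η hη).differentiableAt.differentiableWithinAt)
      (fun η hη => (hder η hη).fderiv) hθ hθ₀
  refine ⟨g θ₀, ?_⟩
  rintro _ ⟨θ, hθ, rfl⟩
  have hc := hconst θ hθ
  rw [hμ.variance_cumulantDeriv hθ, hμ.psi_cumulantDeriv hθ, ← Real.exp_log (hμ.detIn_pos e hθ),
    ← hc, hg]
  rw [show ∀ u v w : ℝ, u + v + (w - (((n : ℝ) + 2) * Real.log (1 + β (cumulantDeriv μ θ)) +
      (u + v))) = w - ((n + 2 : ℕ) : ℝ) * Real.log (1 + β (cumulantDeriv μ θ)) by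
    intro u v w
    push_cast
    ring]
  rw [Real.exp_sub, Real.exp_nat_mul, Real.exp_log (hpos θ hθ)]
  have := (pow_pos (hpos θ hθ) (n + 2)).ne'
  field_simp

end MongeAmpere

/-! ### Conjugate priors -/

section Normalization

variable {X Y : Type*} [MeasurableSpace X] [MeasurableSpace Y]

theorem normalized_smul {c : ℝ≥0∞} (hc : c ≠ 0) (hc' : c ≠ ⊤) (ρ : Measure X) :
    normalized (c • ρ) = normalized ρ := by
  rw [normalized, normalized, Measure.smul_apply, smul_eq_mul, smul_smul,
    ENNReal.mul_inv (Or.inl hc) (Or.inl hc'), mul_right_comm, ENNReal.inv_mul_cancel hc hc',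
    one_mul]

theorem normalized_map (ρ : Measure X) {f : X → Y} (hf : Measurable f) :
    (normalized ρ).map f = normalized (ρ.map f) := by
  rw [normalized, normalized, Measure.map_smul, Measure.map_apply hf MeasurableSet.univ,
    Set.preimage_univ]

theorem isProbabilityMeasure_normalized {ρ : Measure X} (h0 : ρ Set.univ ≠ 0)
    (h1 : ρ Set.univ ≠ ⊤) : IsProbabilityMeasure (normalized ρ) :=
  ⟨by rw [normalized, Measure.smul_apply, smul_eq_mul, ENNReal.inv_mul_cancel h0 h1]⟩

end Normalization

theorem integrable_exp_neg_mul_norm {V : Type*} [NormedAddCommGroup V] [NormedSpace ℝ V]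
    [FiniteDimensional ℝ V] [MeasurableSpace V] [BorelSpace V] (ρ : Measure V)
    [ρ.IsAddHaarMeasure] {δ : ℝ} (hδ : 0 < δ) :
    Integrable (fun x : V => Real.exp (-(δ * ‖x‖))) ρ := by
  set N := Module.finrank ℝ V + 1
  have hN : (Module.finrank ℝ V : ℝ) < (N : ℝ) := by
    exact_mod_cast Nat.lt_succ_self _
  refine ((integrable_one_add_norm (μ := ρ) hN).const_mul
    (N.factorial / δ ^ N * Real.exp δ)).mono' (by fun_prop) (ae_of_all _ fun x => ?_)
  rw [Real.norm_eq_abs, abs_of_pos (Real.exp_pos _), Real.rpow_neg (by positivity),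
    Real.rpow_natCast]
  have h1 := Real.pow_div_factorial_le_exp (δ * (1 + ‖x‖)) (by positivity) N
  have h2 : Real.exp (δ * (1 + ‖x‖)) = Real.exp δ * Real.exp (δ * ‖x‖) := by
    rw [← Real.exp_add]
    ring_nf
  rw [div_le_iff₀ (by positivity), mul_pow, h2] at h1
  rw [Real.exp_neg, ← div_eq_mul_inv, le_div_iff₀ (by positivity), div_mul_eq_mul_div,
    le_div_iff₀ (by positivity), inv_mul_eq_div, div_mul_eq_mul_div,
    div_le_iff₀ (by positivity)]
  linarith

section ChangeOfVariables

variable {E : Type*} [NormedAddCommGroup E] [NormedSpace ℝ E] [FiniteDimensional ℝ E] {n : ℕ}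

/-- The linear isomorphism `E ≃ E*` that sends a basis to its dual basis. -/
noncomputable def toDualBasis (e : Module.Basis (Fin n) ℝ E) : E ≃L[ℝ] StrongDual ℝ E :=
  (e.toDualEquiv.trans LinearMap.toContinuousLinearMap).toContinuousLinearEquiv

theorem toDualBasis_apply_self (e : Module.Basis (Fin n) ℝ E) (j : Fin n) :
    toDualBasis e (e j) = dualBasisVec e j := by
  ext x
  change e.toDual (e j) x = e.repr x j
  rw [Module.Basis.toDual_apply_right]

theorem det_comp_toDualBasis (e : Module.Basis (Fin n) ℝ E) (T : StrongDual ℝ E →L[ℝ] E) :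
    (T ∘L (toDualBasis e : E →L[ℝ] StrongDual ℝ E)).det = detIn e T := by
  rw [ContinuousLinearMap.det, ← LinearMap.det_toMatrix e, detIn]
  congr 1
  ext i j
  rw [LinearMap.toMatrix_apply]
  change e.repr (T (toDualBasis e (e j))) i = _
  rw [toDualBasis_apply_self]
  rfl

variable [MeasurableSpace E] [BorelSpace E] {μ : Measure E}

theorem measurable_cumulantDeriv (μ : Measure E) : Measurable (cumulantDeriv μ) :=
  (bidual E).symm.continuous.measurable.comp (measurable_fderiv ℝ (cumulant μ))

/-- Change of variables under `k'_μ`. The constant compares Haar measure on `E*` with the image of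
Haar measure on `E` under the identification of `E` with `E*`. -/
theorem IsBasis.exists_lintegral_image_cumulantDeriv (hμ : IsBasis μ)
    (e : Module.Basis (Fin n) ℝ E) :
    ∃ c : ℝ≥0∞, c ≠ 0 ∧ c ≠ ⊤ ∧ ∀ A ⊆ Theta μ, MeasurableSet A → ∀ h : E → ℝ≥0∞,
      ∫⁻ m in cumulantDeriv μ '' A, h m ∂Measure.addHaar =
        c * ∫⁻ θ in A, ENNReal.ofReal (detIn e (fderiv ℝ (cumulantDeriv μ) θ)) *
          h (cumulantDeriv μ θ) ∂Measure.addHaar := by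
  set J := toDualBasis e
  set ρ : Measure (StrongDual ℝ E) := (Measure.addHaar : Measure E).map J
  have hρ : ρ.IsAddHaarMeasure := J.isAddHaarMeasure_map _
  have hρc := Measure.isAddLeftInvariant_eq_smul ρ (Measure.addHaar : Measure (StrongDual ℝ E))
  refine ⟨(ρ.addHaarScalarFactor Measure.addHaar : NNReal), ?_, ENNReal.coe_ne_top,
    fun A hA hAm h => ?_⟩
  · exact_mod_cast (Measure.addHaarScalarFactor_pos_of_isAddHaarMeasure ρ
      (Measure.addHaar : Measure (StrongDual ℝ E))).ne'
  have himage : cumulantDeriv μ '' A = (cumulantDeriv μ ∘ J) '' (J ⁻¹' A) := by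
    rw [Set.image_comp, Set.image_preimage_eq _ J.surjective]
  have hder : ∀ x ∈ J ⁻¹' A, HasFDerivWithinAt (cumulantDeriv μ ∘ J)
      (fderiv ℝ (cumulantDeriv μ) (J x) ∘L (J : E →L[ℝ] StrongDual ℝ E)) (J ⁻¹' A) x :=
    fun x hx => ((hμ.hasStrictFDerivAt_cumulantDeriv (hA hx)).hasFDerivAt.comp x
      J.hasFDerivAt).hasFDerivWithinAt
  have hinj : Set.InjOn (cumulantDeriv μ ∘ J) (J ⁻¹' A) := fun x hx y hy hxy =>
    J.injective (hμ.injOn_cumulantDeriv (hA hx) (hA hy) hxy)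
  have hemb : MeasurableEmbedding J := J.toHomeomorph.measurableEmbedding
  rw [himage, lintegral_image_eq_lintegral_abs_det_fderiv_mul _ (hemb.measurable hAm) hder hinj]
  set F : StrongDual ℝ E → ℝ≥0∞ := fun θ =>
    ENNReal.ofReal (detIn e (fderiv ℝ (cumulantDeriv μ) θ)) * h (cumulantDeriv μ θ) with hF
  have h1 : ∀ x ∈ J ⁻¹' A, ENNReal.ofReal
      |(fderiv ℝ (cumulantDeriv μ) (J x) ∘L (J : E →L[ℝ] StrongDual ℝ E)).det| *
        h ((cumulantDeriv μ ∘ J) x) = F (J x) := by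
    intro x hx
    rw [det_comp_toDualBasis, abs_of_pos (hμ.detIn_pos e (hA hx))]
    rfl
  rw [setLIntegral_congr_fun (hemb.measurable hAm) h1, ← hemb.lintegral_map (μ := _) (f := F),
    ← hemb.restrict_map]
  change ∫⁻ θ, F θ ∂(ρ.restrict A) = _
  refine (congrArg (fun ν => ∫⁻ θ, F θ ∂(ν.restrict A)) hρc).trans ?_
  rw [Measure.restrict_smul, lintegral_smul_measure]
  rfl

end ChangeOfVariables

section Prior

variable {E : Type*} [NormedAddCommGroup E] [NormedSpace ℝ E] [FiniteDimensional ℝ E]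
  [MeasurableSpace E] [BorelSpace E] {μ : Measure E} {β : StrongDual ℝ E}

theorem IsBasis.isProbabilityMeasure_prior (hμ : IsBasis μ) {t : ℝ} (ht : 0 < t) {m₀ : E}
    (hm₀ : m₀ ∈ meanDomain μ) : IsProbabilityMeasure (prior μ t m₀) := by
  obtain ⟨θ₀, hθ₀, rfl⟩ := hm₀
  set m₀ := cumulantDeriv μ θ₀
  refine isProbabilityMeasure_normalized ?_ ?_
  · rw [withDensity_apply _ MeasurableSet.univ, Measure.restrict_univ]
    have hcont : ContinuousOn (fun θ : StrongDual ℝ E =>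
        ENNReal.ofReal (Real.exp (t * (θ m₀ - cumulant μ θ)))) (Theta μ) := by
      have hk : ContinuousOn (cumulant μ) (Theta μ) := fun θ hθ =>
        (hμ.hasFDerivAt_cumulant hθ).continuousAt.continuousWithinAt
      have hev : Continuous fun θ : StrongDual ℝ E => θ m₀ := by fun_prop
      exact ENNReal.continuous_ofReal.comp_continuousOn
        (Real.continuous_exp.comp_continuousOn (continuousOn_const.mul (hev.continuousOn.sub hk)))
    intro h0
    rw [lintegral_eq_zero_iff' (hcont.aemeasurable (isOpen_Theta μ).measurableSet)] at h0
    have hne : (Measure.addHaar : Measure (StrongDual ℝ E)) (Theta μ) ≠ 0 :=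
      ((isOpen_Theta μ).measure_pos _ hμ.nonempty).ne'
    refine hne (Measure.restrict_eq_zero.1 (ae_eq_bot.1 (eventually_false_iff_eq_bot.1 ?_)))
    filter_upwards [h0] with θ hθ
    exact (ENNReal.ofReal_pos.2 (Real.exp_pos _)).ne' hθ
  · rw [withDensity_apply _ MeasurableSet.univ, Measure.restrict_univ]
    obtain ⟨c, hc, d, hcd⟩ := hμ.exists_linear_growth hθ₀
    have hint := (integrable_exp_neg_mul_norm (Measure.addHaar : Measure (StrongDual ℝ E))
      (mul_pos ht hc)).const_mul (Real.exp (t * d))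
    refine ne_top_of_le_ne_top (hint.integrableOn (s := Theta μ)).lintegral_lt_top.ne
      (setLIntegral_mono' (isOpen_Theta μ).measurableSet fun θ hθ => ?_)
    rw [← Real.exp_add]
    refine ENNReal.ofReal_le_ofReal (Real.exp_le_exp.2 ?_)
    have := mul_le_mul_of_nonneg_left (hcd θ hθ) ht.le
    linarith

theorem IsSimpleCubic.meanDomainTilde_eq (hF : IsSimpleCubic μ β) :
    meanDomainTilde μ β = meanDomain μ :=
  congrArg (cumulantDeriv μ '' ·) (Set.ext fun θ => ⟨fun h => h.1, fun h =>
    ⟨h, hF.one_add_pos ⟨θ, h, rfl⟩⟩⟩)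

/-- The Jacobian of `k'_μ`, given by the Monge-Ampère equation, turns a conjugate prior into a
prior on the domain of the means with shifted parameters. -/
theorem IsSimpleCubic.map_prior_eq (hF : IsSimpleCubic μ β) {a : E} {b c : ℝ}
    (e : Module.Basis (Fin (Module.finrank ℝ E)) ℝ E)
    (hdet : ∀ m ∈ meanDomain μ, detIn e (variance μ m) =
      (1 + β m) ^ (Module.finrank ℝ E + 2) *
        Real.exp (psi μ m a + b * cumulant μ (psi μ m) + c)) (t : ℝ) (m₀ : E) :
    (prior μ t m₀).map (cumulantDeriv μ) = priorTilde μ β (t + b) (t • m₀ - a) := by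
  have hμ := hF.1
  have hK := measurable_cumulantDeriv μ
  have hΘ := (isOpen_Theta μ).measurableSet
  obtain ⟨C, hC0, hCtop, hC⟩ := hμ.exists_lintegral_image_cumulantDeriv e
  rw [prior, priorTilde, normalized_map _ hK, hF.meanDomainTilde_eq]
  set g : StrongDual ℝ E → ℝ≥0∞ := fun θ =>
    ENNReal.ofReal (Real.exp (t * (θ m₀ - cumulant μ θ))) with hg
  set h : E → ℝ≥0∞ := fun m => ENNReal.ofReal (((1 + β m) ^ (Module.finrank ℝ E + 2))⁻¹ *
    Real.exp (psi μ m (t • m₀ - a) - (t + b) * cumulant μ (psi μ m))) with hh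
  have hD : ENNReal.ofReal (Real.exp c) ≠ 0 := (ENNReal.ofReal_pos.2 (Real.exp_pos _)).ne'
  have hpt : ∀ θ ∈ Theta μ, ENNReal.ofReal (detIn e (fderiv ℝ (cumulantDeriv μ) θ)) *
      h (cumulantDeriv μ θ) = ENNReal.ofReal (Real.exp c) * g θ := by
    intro θ hθ
    have hs := pow_pos (hF.one_add_pos ⟨θ, hθ, rfl⟩) (Module.finrank ℝ E + 2)
    rw [← ENNReal.ofReal_mul (hμ.detIn_pos e hθ).le, ← ENNReal.ofReal_mul (Real.exp_pos c).le,
      ← hμ.variance_cumulantDeriv hθ, hdet _ ⟨θ, hθ, rfl⟩, hμ.psi_cumulantDeriv hθ,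
      mul_mul_mul_comm, mul_inv_cancel₀ hs.ne', one_mul, ← Real.exp_add, ← Real.exp_add,
      map_sub, map_smul, smul_eq_mul]
    congr 2
    ring
  have hmeas : ((Measure.addHaar : Measure E).restrict (meanDomain μ)).withDensity h =
      (C * ENNReal.ofReal (Real.exp c)) •
        (((Measure.addHaar : Measure (StrongDual ℝ E)).restrict (Theta μ)).withDensity g).map
          (cumulantDeriv μ) := by
    ext s hs
    have hA : MeasurableSet (cumulantDeriv μ ⁻¹' s ∩ Theta μ) := (hK hs).inter hΘ
    rw [withDensity_apply _ hs, Measure.restrict_restrict hs, Measure.smul_apply,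
      Measure.map_apply hK hs, withDensity_apply _ (hK hs), Measure.restrict_restrict (hK hs),
      meanDomain, Set.inter_comm s, ← Set.image_inter_preimage, Set.inter_comm (Theta μ),
      hC _ Set.inter_subset_right hA,
      setLIntegral_congr_fun hA fun θ hθ => hpt θ hθ.2,
      lintegral_const_mul' _ _ ENNReal.ofReal_ne_top, smul_eq_mul, mul_assoc]
  rw [hmeas, normalized_smul (mul_ne_zero hC0 hD) (ENNReal.mul_ne_top hCtop ENNReal.ofReal_ne_top)]

theorem IsSimpleCubic.priorProperty (hF : IsSimpleCubic μ β) : PriorProperty μ β := by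
  obtain ⟨a, b, hab⟩ := hF.mongeAmpere
  obtain ⟨c, hc⟩ := hab (Module.finBasis ℝ E)
  have hmap := hF.map_prior_eq (Module.finBasis ℝ E) hc
  -- `Ω` consists of the pairs `(t + b, t m₀ - a)` with `t > 0` and `m₀ ∈ M_F`
  refine ⟨fun t ht m₀ hm₀ => hF.1.isProbabilityMeasure_prior ht hm₀,
    {p | b < p.1} ∩ (fun p : ℝ × E => (p.1 - b)⁻¹ • (p.2 + a)) ⁻¹' meanDomain μ, ?_, ?_⟩
  · refine ContinuousOn.isOpen_inter_preimage ?_ (isOpen_lt continuous_const continuous_fst)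
      hF.1.isOpen_meanDomain
    refine ContinuousOn.smul (ContinuousOn.inv₀ (by fun_prop) fun p hp => ?_) (by fun_prop)
    exact (sub_pos.2 (Set.mem_ofPred.1 hp)).ne'
  · ext ρ
    constructor
    · rintro ⟨t, ht, m₀, hm₀, rfl⟩
      refine ⟨(t + b, t • m₀ - a), ⟨?_, ?_⟩, hmap t m₀⟩
      · simpa using ht
      · change (t + b - b)⁻¹ • (t • m₀ - a + a) ∈ meanDomain μ
        rwa [add_sub_cancel_right, sub_add_cancel, smul_smul, inv_mul_cancel₀ ht.ne', one_smul]
    · rintro ⟨⟨t, u⟩, ⟨ht, hu⟩, rfl⟩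
      have ht' : 0 < t - b := sub_pos.2 ht
      refine ⟨t - b, ht', (t - b)⁻¹ • (u + a), hu, ?_⟩
      rw [hmap, smul_smul, mul_inv_cancel₀ ht'.ne', one_smul, add_sub_cancel_right,
        sub_add_cancel]

end Prior

end NEF

theorem proposition3p1 {E : Type*} [NormedAddCommGroup E] [NormedSpace ℝ E]
    [FiniteDimensional ℝ E] [MeasurableSpace E] [BorelSpace E]
    (μ : MeasureTheory.Measure E) (β : StrongDual ℝ E) (hF : NEF.IsSimpleCubic μ β) :
    NEF.MongeAmpereProperty μ β ∧ NEF.VarianceEquationProperty μ β ∧ NEF.PriorProperty μ β :=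
  ⟨hF.mongeAmpere, hF.varianceEquation, hF.priorProperty⟩
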